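/- Let $w$ be a non-negative bounded (measurable) function on $\mathbb R_+=(0,\infty)$ with bounded support. Let $$\mathbf a(t)=\int_0^\infty t^{-\frac12-\lambda}w(\lambda)\,d\lambda,\qquad t\ge 1,$$ and let $a(j)=\mathbf a(j)$ for $j\in\mathbb N=\{1,2,\dots\}$. Let $M(a)$ be the Helson matrix $\{a(jk)\}_{j,k=1}^\infty$, acting on $\ell^2(\mathbb N)$, and let $\mathbf M(\mathbf a)$ be the integral Helson operator $$(\mathbf M(\mathbf a)f)(t)=\int_1^\infty \mathbf a(ts)f(s)\,ds$$ on $L^2(1,\infty)$. Then $M(a)$ and $\mathbf M(\mathbf a)$ are bounded, $M(a)\ge0$ and $\mathbf M(\mathbf a)\ge0$. Further, there exist bounded self-adjoint operators $A$ and $B$ in $L^2(\mathbb R_+)$ such that $$M(a)\approx A,\qquad \mathbf M(\mathbf a)\approx B,\qquad A-B\in\mathbf S_0.$$ Here, for bounded self-adjoint operators $T_1,T_2$ in Hilbert spaces, $T_1\approx T_2$ (unitary equivalence modulo kernels) means that $T_1|_{(\operatorname{Ker}T_1)^\perp}$ and $T_2|_{(\operatorname{Ker}T_2)^\perp}$ are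 unitarily equivalent. For a compact operator $T$, $\{s_n(T)\}_{n\ge1}$ is the non-increasing sequence of positive eigenvalues of $\sqrt{T^*T}$, repeated according to multiplicity (and extended by zeros if there are finitely many); $\mathbf S_p$, $0<p<\infty$, is the class of compact operators with $\sum_n s_n(T)^p<\infty$, and $\mathbf S_0=\bigcap_{p>0}\mathbf S_p$. -/

import Mathlib

open MeasureTheory

noncomputable section

/-- The sequence space `ℓ²(ℕ)`, `ℕ = {1, 2, 3, …}`. -/
abbrev EllTwo : Type := lp (fun _ : ℕ+ => ℂ) 2

/-- `L²(c, ∞)` with respect to Lebesgue measure. -/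
abbrev LTwoIoi (c : ℝ) : Type := Lp ℂ 2 (volume.restrict (Set.Ioi c))

/-- The kernel function `𝐚(t) = ∫₀^∞ t^{-1/2-x} w(x) dx`. -/
def helsonKernel (w : ℝ → ℝ) (t : ℝ) : ℝ :=
  ∫ x in Set.Ioi (0 : ℝ), t ^ (-(1 / 2 : ℝ) - x) * w x

/-- The bounded operator `T` on `ℓ²(ℕ)` is the Helson matrix `M(a) = {a(jk)}_{j,k ≥ 1}`. -/
def IsHelsonMatrix (a : ℕ+ → ℂ) (T : EllTwo →L[ℂ] EllTwo) : Prop :=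
  ∀ (u : EllTwo) (j : ℕ+), HasSum (fun k : ℕ+ => a (j * k) * u k) (T u j)

/-- The bounded operator `T` on `L²(1, ∞)` is the integral Helson operator
`𝐌(𝐚) : f ↦ ∫₁^∞ 𝐚(ts) f(s) ds`. -/
def IsIntegralHelsonOperator (a : ℝ → ℂ) (T : LTwoIoi 1 →L[ℂ] LTwoIoi 1) : Prop :=
  ∀ f : LTwoIoi 1, ∀ᵐ t ∂(volume.restrict (Set.Ioi (1 : ℝ))),
    IntegrableOn (fun s => a (t * s) * f s) (Set.Ioi 1) ∧
      T f t = ∫ s in Set.Ioi (1 : ℝ), a (t * s) * f s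

section Hilbert

variable {H : Type*} [NormedAddCommGroup H] [InnerProductSpace ℂ H] [CompleteSpace H]
variable {K : Type*} [NormedAddCommGroup K] [InnerProductSpace ℂ K] [CompleteSpace K]

/-- `A ≈ B`: the restrictions of `A` to `(Ker A)^⊥` and of `B` to `(Ker B)^⊥` are operators in
these subspaces and are unitarily equivalent. -/
def UnitarilyEquivModKer (A : H →L[ℂ] H) (B : K →L[ℂ] K) : Prop :=
  ∃ (hA : ∀ x ∈ A.kerᗮ, A x ∈ A.kerᗮ) (hB : ∀ y ∈ B.kerᗮ, B y ∈ B.kerᗮ)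
    (U : A.kerᗮ ≃ₗᵢ[ℂ] B.kerᗮ),
    ∀ x : A.kerᗮ, U ((A : H →ₗ[ℂ] H).restrict hA x) = (B : K →ₗ[ℂ] K).restrict hB (U x)

/-- For a compact self-adjoint operator `T`, the `(n+1)`-st term of the non-increasing sequence of
its positive eigenvalues, repeated according to multiplicity (and `0` if there are at most `n`):
the largest `μ > 0` such that at least `n + 1` eigenvalues, counted with multiplicity,
are `≥ μ`. -/
def posEigenvalue (T : H →L[ℂ] H) (n : ℕ) : ℝ :=
  sSup {μ : ℝ | 0 < μ ∧ ∃ e : Fin (n + 1) → H, Orthonormal ℂ e ∧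
    ∀ i, ∃ ν : ℝ, μ ≤ ν ∧ T (e i) = (ν : ℂ) • e i}

/-- The singular values of a compact operator, i.e. the eigenvalues of `√(A* A)`, with indices
starting at `0`. -/
def singularValue (A : H →L[ℂ] H) (n : ℕ) : ℝ :=
  posEigenvalue (CFC.sqrt (star A * A)) n

/-- The Schatten class `S_p`, `0 < p < ∞`. -/
def MemSchatten (p : ℝ) (A : H →L[ℂ] H) : Prop :=
  IsCompactOperator A ∧ Summable fun n : ℕ => singularValue A n ^ p

/-- The class `S_0`, the intersection of all `S_p` with `p > 0`. -/
def MemSchattenZero (A : H →L[ℂ] H) : Prop :=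
  ∀ p : ℝ, 0 < p → MemSchatten p A

end Hilbert

end

/-! ### Polar decomposition, and singular values via finite-rank approximation. -/

section OperatorTheory

open ContinuousLinearMap

variable {H : Type*} [NormedAddCommGroup H] [InnerProductSpace ℂ H] [CompleteSpace H]
variable {K : Type*} [NormedAddCommGroup K] [InnerProductSpace ℂ K] [CompleteSpace K]

/-! Write `w = v²` almost everywhere. Splitting `(ts)^(-1/2-x) w(x)` into `t^(-1/2-x) v(x)` times
`s^(-1/2-x) v(x)` factors both operators: the Helson matrix is `S S*` and the integral operator is
`T T*`, where `S` and `T` map `L²(0,∞)` into `ℓ²` and `L²(1,∞)` with kernel `t^(-1/2-x) v(x)`, `t`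
being an integer `j ≥ 1` or a real number `> 1`. Positivity is then immediate, and the polar
decomposition (`unitarilyEquivModKer_adjoint_comp_self`) allows the choice `A = S* S`, `B = T* T`.

These live on the same space and have explicit kernels: `v(x) v(y) ζ(1+x+y)` for `A`, since the sum
over `j` of `j^(-1-x-y)` is a zeta value, and `v(x) v(y)/(x+y)` for `B`. Both are `O(1/(x+y))` on
the bounded support of `v`, so Hilbert's inequality (`lintegral_sq_kernel_le`) makes `S` and `T`
bounded.

In `A - B` the pole of zeta cancels, leaving `v(x) v(y) K(x+y)` with `K` entire
(`exists_entire_zeta_sub_pole`). Keeping the Taylor terms of `K` of degree below `n` gives an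
operator of rank at most `n`, because `(x+y)^m` is a combination of products `x^i y^(m-i)`. The
error is `O(2^(-n))`, hence so are the singular values, and they are summable to every power `p >
0`. -/

/-- The modulus of an operator squares to `S* S`. -/
theorem sqrt_adjoint_comp_self_apply (S : H →L[ℂ] K) (x : H) :
    CFC.sqrt (adjoint S ∘L S) (CFC.sqrt (adjoint S ∘L S) x) = adjoint S (S x) := by
  have h0 : (0 : H →L[ℂ] H) ≤ adjoint S ∘L S :=
    (nonneg_iff_isPositive _).2 (isPositive_adjoint_comp_self S)
  have := CFC.sqrt_mul_sqrt_self (adjoint S ∘L S) h0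
  exact congrArg (fun T : H →L[ℂ] H => T x) this

theorem adjoint_sqrt_adjoint_comp_self (S : H →L[ℂ] K) :
    adjoint (CFC.sqrt (adjoint S ∘L S)) = CFC.sqrt (adjoint S ∘L S) :=
  (IsSelfAdjoint.of_nonneg (CFC.sqrt_nonneg (adjoint S ∘L S))).adjoint_eq

theorem norm_sqrt_adjoint_comp_self_apply (S : H →L[ℂ] K) (x : H) :
    ‖CFC.sqrt (adjoint S ∘L S) x‖ = ‖S x‖ := by
  have h : inner ℂ (CFC.sqrt (adjoint S ∘L S) x) (CFC.sqrt (adjoint S ∘L S) x)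
      = inner ℂ (S x) (S x) := by
    rw [← adjoint_inner_right, adjoint_sqrt_adjoint_comp_self, sqrt_adjoint_comp_self_apply,
      adjoint_inner_right]
  rw [inner_self_eq_norm_sq_to_K, inner_self_eq_norm_sq_to_K] at h
  have h2 : ‖CFC.sqrt (adjoint S ∘L S) x‖ ^ 2 = ‖S x‖ ^ 2 := by exact_mod_cast h
  exact (pow_left_inj₀ (norm_nonneg _) (norm_nonneg _) two_ne_zero).1 h2

/-- The closure of the range of `S` is the orthogonal complement of `ker S*`. A separate `V` with
the same kernel is allowed so that the target can be the complement of the kernel of `S* S` or `S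
S*`. -/
theorem denseRange_codRestrict_orthogonal_ker {G : Type*} [NormedAddCommGroup G]
    [InnerProductSpace ℂ G] [CompleteSpace G] (S : H →L[ℂ] K) (V : K →L[ℂ] G)
    (h : V.ker = (adjoint S).ker) (hS : ∀ x, S x ∈ V.kerᗮ) :
    DenseRange ((S : H →ₗ[ℂ] K).codRestrict V.kerᗮ hS) := by
  have hcl : V.kerᗮ = S.range.topologicalClosure := by
    rw [h, orthogonal_ker, adjoint_adjoint]
  intro y
  rw [closure_subtype]
  have hy : (y : K) ∈ closure (S.range : Set K) := by
    exact hcl.le y.2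
  convert hy using 2
  ext z
  constructor
  · rintro ⟨_, ⟨x, rfl⟩, rfl⟩
    exact ⟨x, rfl⟩
  · rintro ⟨x, rfl⟩
    exact ⟨⟨S x, hS x⟩, ⟨x, rfl⟩, rfl⟩

/-- `S* S` and `S S*` are unitarily equivalent modulo kernels. -/
theorem unitarilyEquivModKer_adjoint_comp_self (S : H →L[ℂ] K) :
    UnitarilyEquivModKer (adjoint S ∘L S) (S ∘L adjoint S) := by
  set P : H →L[ℂ] H := CFC.sqrt (adjoint S ∘L S) with hP
  have hPsa : adjoint P = P := adjoint_sqrt_adjoint_comp_self S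
  have hPP : ∀ x, P (P x) = adjoint S (S x) := sqrt_adjoint_comp_self_apply S
  have hPn : ∀ x, ‖P x‖ = ‖S x‖ := norm_sqrt_adjoint_comp_self_apply S
  have hker₁ : (adjoint S ∘L S).ker = (adjoint P).ker := by
    rw [ker_adjoint_comp_self, hPsa]
    ext x
    simp only [LinearMap.mem_ker, coe_coe]
    rw [← norm_eq_zero, ← hPn, norm_eq_zero]
  have hker₂ : (S ∘L adjoint S).ker = (adjoint S).ker := ker_self_comp_adjoint S
  have mem₁ : ∀ x, P x ∈ (adjoint S ∘L S).kerᗮ := fun x => by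
    rw [hker₁, orthogonal_ker, adjoint_adjoint]
    exact Submodule.le_topologicalClosure _ ⟨x, rfl⟩
  have mem₂ : ∀ x, S x ∈ (S ∘L adjoint S).kerᗮ := fun x => by
    rw [hker₂, orthogonal_ker, adjoint_adjoint]
    exact Submodule.le_topologicalClosure _ ⟨x, rfl⟩
  have hA : ∀ x ∈ (adjoint S ∘L S).kerᗮ, (adjoint S ∘L S) x ∈ (adjoint S ∘L S).kerᗮ :=
    fun x _ => by
      have := mem₁ (P x)
      rwa [hPP] at this
  have hB : ∀ x ∈ (S ∘L adjoint S).kerᗮ, (S ∘L adjoint S) x ∈ (S ∘L adjoint S).kerᗮ :=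
    fun x _ => mem₂ (adjoint S x)
  have d₁ := denseRange_codRestrict_orthogonal_ker P (adjoint S ∘L S) hker₁ mem₁
  have d₂ := denseRange_codRestrict_orthogonal_ker S (S ∘L adjoint S) hker₂ mem₂
  set e₁ := (P : H →ₗ[ℂ] H).codRestrict _ mem₁ with he₁
  set e₂ := (S : H →ₗ[ℂ] K).codRestrict _ mem₂ with he₂
  -- The polar isometry `|S| x ↦ S x`, extended by continuity from dense ranges.
  let U := (LinearEquiv.refl ℂ H).extendOfIsometry e₁ e₂ d₁ d₂ (fun x => (hPn x).symm)
  have hU : ∀ x, U (e₁ x) = e₂ x := fun x =>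
    LinearEquiv.extendOfIsometry_eq (LinearEquiv.refl ℂ H) e₁ e₂ d₁ d₂ (fun x => (hPn x).symm) x
  refine ⟨hA, hB, U, fun x => ?_⟩
  refine d₁.induction_on (p := fun x =>
      U (((adjoint S ∘L S : H →L[ℂ] H) : H →ₗ[ℂ] H).restrict hA x)
      = ((S ∘L adjoint S : K →L[ℂ] K) : K →ₗ[ℂ] K).restrict hB (U x)) x ?_ ?_
  · refine isClosed_eq (U.continuous.comp ?_) (Continuous.comp ?_ U.continuous)
    · exact Continuous.subtype_mk ((adjoint S ∘L S).continuous.comp continuous_subtype_val) _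
    · exact Continuous.subtype_mk ((S ∘L adjoint S).continuous.comp continuous_subtype_val) _
  · intro x
    -- Intertwining on the dense range: `S* S |S| x = |S| (|S|² x)` is sent to `S |S|² x = S S* (S
    -- x)`.
    have h1 : ((adjoint S ∘L S : H →L[ℂ] H) : H →ₗ[ℂ] H).restrict hA (e₁ x) = e₁ (P (P x)) := by
      apply Subtype.ext
      change adjoint S (S (P x)) = P (P (P x))
      rw [← hPP]
    rw [h1, hU, hU, hPP]
    rfl

/-- The singular values of `D` are bounded by the distance to operators of rank at most `n`. -/
theorem singularValue_le_norm_sub (D F : H →L[ℂ] H) (n : ℕ) (V : Submodule ℂ H)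
    [FiniteDimensional ℂ V] (hV : Module.finrank ℂ V ≤ n) (hF : ∀ x, F x ∈ V) :
    singularValue D n ≤ ‖D - F‖ := by
  refine Real.sSup_le ?_ (norm_nonneg _)
  rintro μ ⟨hμ, e, he, hev⟩
  choose ν hν hTe using hev
  -- Among combinations of `n + 1` orthonormal eigenvectors of `|D|` with eigenvalues at least `μ`,
  -- a nonzero one is killed by `F`, whose rank is at most `n`. On it `μ ‖x‖ ≤ ‖|D| x‖ = ‖(D - F)
  -- x‖`.
  let L : (Fin (n + 1) → ℂ) →ₗ[ℂ] V :=
    ((F : H →ₗ[ℂ] H).codRestrict V hF) ∘ₗ Fintype.linearCombination ℂ e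
  have hlt : Module.finrank ℂ V < Module.finrank ℂ (Fin (n + 1) → ℂ) := by
    simp only [Module.finrank_fintype_fun_eq_card, Fintype.card_fin]; omega
  obtain ⟨c, hc, hc0⟩ :=
    (Submodule.ne_bot_iff _).1 (LinearMap.ker_ne_bot_of_finrank_lt (f := L) hlt)
  set x : H := ∑ i, c i • e i with hx
  have hFx : F x = 0 := by
    have := congrArg Subtype.val (LinearMap.mem_ker.1 hc)
    simpa [L, Fintype.linearCombination_apply, hx] using this
  have hnorm : ∀ d : Fin (n + 1) → ℂ, ‖∑ i, d i • e i‖ ^ 2 = ∑ i, ‖d i‖ ^ 2 := by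
    intro d
    have h := he.inner_sum d d Finset.univ
    rw [inner_self_eq_norm_sq_to_K] at h
    have h2 : ((‖∑ i, d i • e i‖ ^ 2 : ℝ) : ℂ) = ((∑ i, ‖d i‖ ^ 2 : ℝ) : ℂ) := by
      push_cast
      rw [← Complex.coe_algebraMap] at *
      refine h.trans (Finset.sum_congr rfl fun i _ => ?_)
      exact Complex.conj_mul' _
    exact_mod_cast h2
  have hxpos : 0 < ‖x‖ ^ 2 := by
    rw [hx, hnorm]
    obtain ⟨i, hi⟩ := Function.ne_iff.1 hc0
    exact Finset.sum_pos' (fun i _ => by positivity)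
      ⟨i, Finset.mem_univ _, by have := norm_pos_iff.2 hi; positivity⟩
  have hPx : CFC.sqrt (star D * D) x = ∑ i, ((ν i : ℂ) * c i) • e i := by
    rw [hx, map_sum]
    refine Finset.sum_congr rfl fun i _ => ?_
    rw [map_smul, hTe, smul_smul, mul_comm]
  have h1 : ‖CFC.sqrt (star D * D) x‖ = ‖(D - F) x‖ := by
    rw [sub_apply, hFx, sub_zero]
    exact norm_sqrt_adjoint_comp_self_apply D x
  have h2 : μ ^ 2 * ‖x‖ ^ 2 ≤ ‖CFC.sqrt (star D * D) x‖ ^ 2 := by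
    rw [hPx, hnorm, hnorm, Finset.mul_sum]
    refine Finset.sum_le_sum fun i _ => ?_
    rw [norm_mul, mul_pow, Complex.norm_real, Real.norm_eq_abs, sq_abs]
    have := hν i
    gcongr
  have h3 : ‖(D - F) x‖ ^ 2 ≤ ‖D - F‖ ^ 2 * ‖x‖ ^ 2 := by
    rw [← mul_pow]
    gcongr
    exact (D - F).le_opNorm x
  rw [h1] at h2
  have h4 := le_of_mul_le_mul_right (h2.trans h3) hxpos
  exact le_of_sq_le_sq h4 (norm_nonneg _)

theorem singularValue_nonneg (D : H →L[ℂ] H) (n : ℕ) : 0 ≤ singularValue D n :=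
  Real.sSup_nonneg fun _ h => h.1.le

/-- An operator with geometrically fast finite-rank approximation is in every Schatten class. -/
theorem memSchattenZero_of_geometric_approx (D : H →L[ℂ] H) (F : ℕ → H →L[ℂ] H)
    (V : ℕ → Submodule ℂ H) [∀ n, FiniteDimensional ℂ (V n)]
    (hV : ∀ n, Module.finrank ℂ (V n) ≤ n) (hF : ∀ n x, F n x ∈ V n) (C r : ℝ) (hr0 : 0 ≤ r)
    (hr : r < 1) (hD : ∀ n, ‖D - F n‖ ≤ C * r ^ n) : MemSchattenZero D := by
  intro p hp
  constructor
  · have hlim : Filter.Tendsto F Filter.atTop (nhds D) := by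
      rw [tendsto_iff_norm_sub_tendsto_zero]
      refine squeeze_zero (fun _ => norm_nonneg _) (g := fun n => C * r ^ n)
        (fun n => by rw [norm_sub_rev]; exact hD n) ?_
      simpa using (tendsto_pow_atTop_nhds_zero_of_lt_one hr0 hr).const_mul C
    refine isCompactOperator_of_tendsto hlim (Filter.Eventually.of_forall fun n => ?_)
    have := FiniteDimensional.proper ℂ (V n)
    let G : H →L[ℂ] V n := (F n).codRestrict (V n) (hF n)
    have h1 : IsCompactOperator G := isCompactOperator_of_locallyCompactSpace_dom G
    exact h1.clm_comp (V n).subtypeL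
  · have hC : 0 ≤ C := by simpa using (norm_nonneg _).trans (hD 0)
    have hrp : r ^ p < 1 := Real.rpow_lt_one hr0 hr hp
    refine Summable.of_nonneg_of_le (fun n => Real.rpow_nonneg (singularValue_nonneg D n) p)
      (fun n => ?_) ((summable_geometric_of_lt_one (Real.rpow_nonneg hr0 p) hrp).mul_left (C ^ p))
    calc singularValue D n ^ p ≤ (C * r ^ n) ^ p :=
          Real.rpow_le_rpow (singularValue_nonneg D n)
            ((singularValue_le_norm_sub D (F n) n (V n) (hV n) (hF n)).trans (hD n)) hp.le
      _ = C ^ p * (r ^ p) ^ n := by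
          rw [Real.mul_rpow hC (by positivity), ← Real.rpow_natCast, ← Real.rpow_mul hr0,
            mul_comm (n : ℝ), Real.rpow_mul hr0, Real.rpow_natCast]

end OperatorTheory

/-! ### The zeta function near its pole, and Taylor approximation. -/

section Zeta

open Filter Topology

/-- `ζ(1 + z) - 1 / z` extends to an entire function. -/
theorem exists_entire_zeta_sub_pole : ∃ K : ℂ → ℂ, Differentiable ℂ K ∧
    ∀ z : ℂ, z ≠ 0 → K z = riemannZeta (1 + z) - 1 / z := by
  -- The value `1` at `0` is the residue of zeta, so the singularity of `z ζ(1+z)` is removable. The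
  -- required function is the difference quotient `(g z - g 0) / z`.
  set g : ℂ → ℂ := Function.update (fun z => z * riemannZeta (1 + z)) 0 1 with hg
  have hg_ne : ∀ z, z ≠ 0 → g z = z * riemannZeta (1 + z) := fun z hz => by
    simp [hg, hz]
  have hg0 : g 0 = 1 := by simp [hg]
  have hcont : ContinuousAt g 0 := by
    rw [hg, continuousAt_update_same]
    have h1 : Tendsto (fun z : ℂ => 1 + z) (𝓝[≠] 0) (𝓝[≠] 1) := by
      refine tendsto_nhdsWithin_iff.2 ⟨?_, ?_⟩
      · have : Tendsto (fun z : ℂ => 1 + z) (𝓝 0) (𝓝 (1 + 0)) :=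
          (continuous_const.add continuous_id).tendsto 0
        rw [add_zero] at this
        exact this.mono_left nhdsWithin_le_nhds
      · filter_upwards [self_mem_nhdsWithin] with z hz
        simpa using hz
    refine (riemannZeta_residue_one.comp h1).congr fun z => ?_
    simp
  have hdiff : Differentiable ℂ g := by
    rw [← differentiableOn_univ]
    refine (Complex.differentiableOn_compl_singleton_and_continuousAt_iff
      (c := 0) Filter.univ_mem).1 ⟨?_, hcont⟩
    have h2 : DifferentiableOn ℂ (fun z : ℂ => z * riemannZeta (1 + z)) (Set.univ \ {0}) := by
      intro z hz
      have hz0 : z ≠ 0 := by simpa using hz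
      have h3 : DifferentiableAt ℂ riemannZeta (1 + z) :=
        differentiableAt_riemannZeta (by simpa using hz0)
      have h4 : DifferentiableAt ℂ (fun z : ℂ => riemannZeta (1 + z)) z :=
        DifferentiableAt.comp z h3 (by fun_prop)
      exact (differentiableAt_id.mul h4).differentiableWithinAt
    exact h2.congr fun z hz => hg_ne z (by simpa using hz)
  refine ⟨dslope g 0, ?_, fun z hz => ?_⟩
  · rw [← differentiableOn_univ, Complex.differentiableOn_dslope Filter.univ_mem]
    exact hdiff.differentiableOn
  · rw [dslope_of_ne _ hz, slope_def_field, hg_ne z hz, hg0]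
    field_simp
    ring

theorem summable_pnat_rpow {s : ℝ} (hs : 0 < s) :
    Summable fun j : ℕ+ => (j : ℝ) ^ (-1 - s) := by
  have h : Summable fun n : ℕ => (n : ℝ) ^ (-1 - s) :=
    Real.summable_nat_rpow.2 (by linarith)
  exact h.comp_injective PNat.coe_injective

theorem tsum_pnat_rpow_eq_zeta {s : ℝ} (hs : 0 < s) :
    ((∑' j : ℕ+, (j : ℝ) ^ (-1 - s) : ℝ) : ℂ) = riemannZeta (1 + s) := by
  rw [zeta_eq_tsum_one_div_nat_add_one_cpow (by simpa using hs), Complex.ofReal_tsum,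
    ← Equiv.pnatEquivNat.symm.tsum_eq]
  refine tsum_congr fun n => ?_
  rw [Complex.ofReal_cpow (by positivity)]
  simp only [Equiv.pnatEquivNat_symm_apply, Nat.succPNat_coe, Nat.succ_eq_add_one]
  push_cast
  rw [one_div, ← Complex.cpow_neg]
  congr 1
  ring

/-- Taylor polynomials of an entire function converge geometrically on bounded sets. -/
theorem exists_taylor_geometric {K : ℂ → ℂ} (hK : Differentiable ℂ K) (ρ : ℝ) (hρ : 0 ≤ ρ) :
    ∃ (c : ℕ → ℂ) (C : ℝ), ∀ (n : ℕ) (z : ℂ), ‖z‖ ≤ ρ →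
      ‖K z - ∑ m ∈ Finset.range n, c m * z ^ m‖ ≤ C * (1 / 2) ^ n := by
  obtain ⟨c, hc⟩ : ∃ c : ℕ → ℂ, ∀ z, HasSum (fun m => c m * z ^ m) (K z) := by
    refine ⟨fun m => (m.factorial : ℂ)⁻¹ * iteratedDeriv m K 0, fun z => ?_⟩
    have := Complex.hasSum_taylorSeries_of_entire hK 0 z
    refine this.congr_fun ?_
    intro m
    simp only [sub_zero, smul_eq_mul]
    ring
  have hsum : Summable fun m => ‖c m‖ * (2 * ρ) ^ m := by
    -- Absolute convergence at twice the radius is what gains the factor `2^(-n)` in the tail.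
    have := (hc ((2 * ρ : ℝ) : ℂ)).summable.norm
    refine this.congr fun m => ?_
    rw [norm_mul, norm_pow, Complex.norm_real, Real.norm_of_nonneg (by positivity)]
  refine ⟨c, ∑' m, ‖c m‖ * (2 * ρ) ^ m, fun n z hz => ?_⟩
  have h1 : HasSum (fun m => c (m + n) * z ^ (m + n)) (K z - ∑ m ∈ Finset.range n, c m * z ^ m) :=
    (hasSum_nat_add_iff' n).2 (hc z)
  have hsn : Summable fun m => ‖c (m + n)‖ * (2 * ρ) ^ (m + n) :=
    (summable_nat_add_iff n).2 hsum
  rw [← h1.tsum_eq]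
  refine (tsum_of_norm_bounded (hsn.mul_right ((1 / 2) ^ n)).hasSum fun m => ?_).trans ?_
  · rw [norm_mul, norm_pow, mul_assoc]
    refine mul_le_mul_of_nonneg_left ?_ (norm_nonneg _)
    calc ‖z‖ ^ (m + n) ≤ ρ ^ (m + n) := by gcongr
      _ ≤ 2 ^ m * ρ ^ (m + n) :=
          le_mul_of_one_le_left (by positivity) (one_le_pow₀ (by norm_num))
      _ = (2 * ρ) ^ (m + n) * (1 / 2) ^ n := by
          rw [mul_pow, pow_add 2, one_div, inv_pow]
          field_simp
  · rw [tsum_mul_right]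
    refine mul_le_mul_of_nonneg_right ?_ (by positivity)
    have := hsum.sum_add_tsum_nat_add n
    rw [← this]
    exact le_add_of_nonneg_left (Finset.sum_nonneg fun _ _ => by positivity)

end Zeta

/-! ### Hilbert's inequality by a Schur test. -/

section HilbertInequality

open Set
open scoped ENNReal

/-- The Schur test integral for the weight `(x/y)^(1/2)`. Bounding `1/(x+y)` by `1/x` for `y ≤ x`
and by `1/y` for `y > x` makes each half at most `2`. -/
theorem lintegral_hilbert_kernel_weight_le {x : ℝ} (hx : 0 < x) :
    ∫⁻ y in Ioi (0 : ℝ),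
      ENNReal.ofReal (x ^ (1 / 2 : ℝ) * y ^ (-(1 / 2) : ℝ) * (1 / (x + y))) ≤ 4 := by
  have hsplit : Ioi (0 : ℝ) = Ioc 0 x ∪ Ioi x := (Ioc_union_Ioi_eq_Ioi hx.le).symm
  rw [hsplit]
  refine (lintegral_union_le _ _ _).trans ?_
  have h1 : ∫⁻ y in Ioc (0 : ℝ) x,
      ENNReal.ofReal (x ^ (1 / 2 : ℝ) * y ^ (-(1 / 2) : ℝ) * (1 / (x + y))) ≤ 2 := by
    calc _ ≤ ∫⁻ y in Ioc (0 : ℝ) x, ENNReal.ofReal (x ^ (-(1 / 2) : ℝ) * y ^ (-(1 / 2) : ℝ)) := by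
          refine setLIntegral_mono' measurableSet_Ioc fun y hy => ENNReal.ofReal_le_ofReal ?_
          have hy0 : 0 < y := hy.1
          have hp : 0 < y ^ (-(1 / 2) : ℝ) := Real.rpow_pos_of_pos hy0 _
          have hq : 0 < x ^ (1 / 2 : ℝ) := Real.rpow_pos_of_pos hx _
          have e : x ^ (-(1 / 2) : ℝ) = x ^ (1 / 2 : ℝ) * (1 / x) := by
            rw [one_div x, ← Real.rpow_neg_one x, ← Real.rpow_add hx]; norm_num
          rw [e, mul_right_comm (x ^ (1 / 2 : ℝ)) (1 / x)]
          gcongr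
          linarith
      _ = ENNReal.ofReal (∫ y in Ioc (0 : ℝ) x, x ^ (-(1 / 2) : ℝ) * y ^ (-(1 / 2) : ℝ)) := by
          rw [ofReal_integral_eq_lintegral_ofReal]
          · refine Integrable.const_mul ?_ _
            have := intervalIntegral.intervalIntegrable_rpow' (a := 0) (b := x)
              (r := (-(1 / 2) : ℝ)) (by norm_num)
            exact (intervalIntegrable_iff_integrableOn_Ioc_of_le hx.le).1 this
          · filter_upwards [ae_restrict_mem measurableSet_Ioc] with y hy
            have hy0 : 0 < y := hy.1
            simp only [Pi.zero_apply]
            positivity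
      _ = 2 := by
          rw [integral_const_mul, ← intervalIntegral.integral_of_le hx.le,
            integral_rpow (Or.inl (by norm_num))]
          rw [Real.zero_rpow (by norm_num), sub_zero, mul_div_assoc', ← Real.rpow_add hx]
          norm_num
  have h2 : ∫⁻ y in Ioi x,
      ENNReal.ofReal (x ^ (1 / 2 : ℝ) * y ^ (-(1 / 2) : ℝ) * (1 / (x + y))) ≤ 2 := by
    calc _ ≤ ∫⁻ y in Ioi x, ENNReal.ofReal (x ^ (1 / 2 : ℝ) * y ^ (-(3 / 2) : ℝ)) := by
          refine setLIntegral_mono' measurableSet_Ioi fun y hy => ENNReal.ofReal_le_ofReal ?_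
          have hy0 : 0 < y := hx.trans hy
          have hp : 0 < y ^ (-(1 / 2) : ℝ) := Real.rpow_pos_of_pos hy0 _
          have hq : 0 < x ^ (1 / 2 : ℝ) := Real.rpow_pos_of_pos hx _
          have e : y ^ (-(3 / 2) : ℝ) = y ^ (-(1 / 2) : ℝ) * (1 / y) := by
            rw [one_div y, ← Real.rpow_neg_one y, ← Real.rpow_add hy0]; norm_num
          rw [e, mul_assoc]
          gcongr
          linarith
      _ = ENNReal.ofReal (∫ y in Ioi x, x ^ (1 / 2 : ℝ) * y ^ (-(3 / 2) : ℝ)) := by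
          rw [ofReal_integral_eq_lintegral_ofReal]
          · exact Integrable.const_mul (integrableOn_Ioi_rpow_of_lt (by norm_num) hx) _
          · filter_upwards [ae_restrict_mem measurableSet_Ioi] with y hy
            have hy0 : 0 < y := hx.trans hy
            simp only [Pi.zero_apply]
            positivity
      _ = 2 := by
          rw [integral_const_mul, integral_Ioi_rpow_of_lt (by norm_num) hx, mul_div_assoc',
            mul_neg, ← Real.rpow_add hx]
          norm_num
  calc _ ≤ (2 : ℝ≥0∞) + 2 := add_le_add h1 h2
    _ = 4 := by norm_num

theorem ENNReal.mul_le_sq_add_sq (a b : ℝ≥0∞) : a * b ≤ a ^ 2 + b ^ 2 := by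
  rcases le_total a b with h | h
  · calc a * b ≤ b * b := by gcongr
      _ = b ^ 2 := (sq b).symm
      _ ≤ _ := le_add_self
  · calc a * b ≤ a * a := by gcongr
      _ = a ^ 2 := (sq a).symm
      _ ≤ _ := le_self_add

/-- Schur splitting: `ab = (ac)(bd)` with `c = (x/y)^(1/4)` and `d = 1/c`, followed by a crude
arithmetic-geometric bound. Each summand then contains only one of the two factors. -/
theorem mul_mul_hilbert_kernel_le (a b : ℝ≥0∞) {x y : ℝ} (hx : 0 < x) (hy : 0 < y) :
    a * b * ENNReal.ofReal (1 / (x + y)) ≤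
      a ^ 2 * ENNReal.ofReal (x ^ (1 / 2 : ℝ) * y ^ (-(1 / 2) : ℝ) * (1 / (x + y))) +
      b ^ 2 * ENNReal.ofReal (y ^ (1 / 2 : ℝ) * x ^ (-(1 / 2) : ℝ) * (1 / (y + x))) := by
  set c := ENNReal.ofReal (x ^ (1 / 4 : ℝ) * y ^ (-(1 / 4) : ℝ)) with hc
  set d := ENNReal.ofReal (y ^ (1 / 4 : ℝ) * x ^ (-(1 / 4) : ℝ)) with hd
  have hcd : c * d = 1 := by
    rw [hc, hd, ← ENNReal.ofReal_mul (by positivity)]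
    have : x ^ (1 / 4 : ℝ) * y ^ (-(1 / 4) : ℝ) * (y ^ (1 / 4 : ℝ) * x ^ (-(1 / 4) : ℝ)) = 1 := by
      rw [Real.rpow_neg hx.le, Real.rpow_neg hy.le]
      have := Real.rpow_pos_of_pos hx (1 / 4)
      have := Real.rpow_pos_of_pos hy (1 / 4)
      field_simp
    rw [this, ENNReal.ofReal_one]
  have hsq : ∀ {u v : ℝ}, 0 < u → 0 < v → ENNReal.ofReal (u ^ (1 / 4 : ℝ) * v ^ (-(1 / 4) : ℝ)) ^ 2
      = ENNReal.ofReal (u ^ (1 / 2 : ℝ) * v ^ (-(1 / 2) : ℝ)) := by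
    intro u v hu hv
    rw [← ENNReal.ofReal_pow (by positivity), mul_pow, ← Real.rpow_natCast, ← Real.rpow_natCast,
      ← Real.rpow_mul hu.le, ← Real.rpow_mul hv.le]
    norm_num
  have key : a * b ≤ a ^ 2 * c ^ 2 + b ^ 2 * d ^ 2 := by
    calc a * b = (a * c) * (b * d) := by
          rw [mul_mul_mul_comm, hcd, mul_one]
      _ ≤ _ := by
          rw [← mul_pow, ← mul_pow]
          exact ENNReal.mul_le_sq_add_sq _ _
  rw [hc, hd, hsq hx hy, hsq hy hx] at key
  rw [ENNReal.ofReal_mul (p := x ^ (1 / 2 : ℝ) * y ^ (-(1 / 2) : ℝ)) (by positivity),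
    ENNReal.ofReal_mul (p := y ^ (1 / 2 : ℝ) * x ^ (-(1 / 2) : ℝ)) (by positivity), add_comm y x,
    ← mul_assoc, ← mul_assoc, ← add_mul]
  gcongr

/-- The Hilbert inequality for the Carleman kernel `1 / (x + y)`. -/
theorem lintegral_lintegral_hilbert_kernel_le {g : ℝ → ℝ≥0∞} (hg : Measurable g) :
    ∫⁻ x in Ioi (0 : ℝ), ∫⁻ y in Ioi (0 : ℝ), g x * g y * ENNReal.ofReal (1 / (x + y)) ≤
      8 * ∫⁻ x in Ioi (0 : ℝ), g x ^ 2 := by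
  set G : ℝ → ℝ → ℝ≥0∞ := fun x y =>
    g x ^ 2 * ENNReal.ofReal (x ^ (1 / 2 : ℝ) * y ^ (-(1 / 2) : ℝ) * (1 / (x + y))) with hG
  have hGm : Measurable (Function.uncurry G) := by
    unfold Function.uncurry
    fun_prop
  have hGle : ∫⁻ x in Ioi (0 : ℝ), ∫⁻ y in Ioi (0 : ℝ), G x y ≤
      4 * ∫⁻ x in Ioi (0 : ℝ), g x ^ 2 := by
    rw [← lintegral_const_mul _ (by fun_prop)]
    refine setLIntegral_mono' measurableSet_Ioi fun x hx => ?_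
    rw [lintegral_const_mul _ (by fun_prop), mul_comm]
    gcongr
    exact lintegral_hilbert_kernel_weight_le hx
  calc _ ≤ ∫⁻ x in Ioi (0 : ℝ), ∫⁻ y in Ioi (0 : ℝ), (G x y + G y x) := by
        refine setLIntegral_mono' measurableSet_Ioi fun x hx => ?_
        refine setLIntegral_mono' measurableSet_Ioi fun y hy => ?_
        exact mul_mul_hilbert_kernel_le _ _ hx hy
    _ = (∫⁻ x in Ioi (0 : ℝ), ∫⁻ y in Ioi (0 : ℝ), G x y) +
        ∫⁻ x in Ioi (0 : ℝ), ∫⁻ y in Ioi (0 : ℝ), G y x := by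
        rw [← lintegral_add_left (f := fun x => ∫⁻ y in Ioi (0 : ℝ), G x y) hGm.lintegral_prod_right']
        refine lintegral_congr fun x => lintegral_add_left ?_ _
        exact hGm.comp measurable_prodMk_left
    _ = (∫⁻ x in Ioi (0 : ℝ), ∫⁻ y in Ioi (0 : ℝ), G x y) +
        ∫⁻ x in Ioi (0 : ℝ), ∫⁻ y in Ioi (0 : ℝ), G x y := by
        congr 1
        exact lintegral_lintegral_swap (hGm.comp measurable_swap).aemeasurable
    _ ≤ 4 * (∫⁻ x in Ioi (0 : ℝ), g x ^ 2) + 4 * ∫⁻ x in Ioi (0 : ℝ), g x ^ 2 :=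
        add_le_add hGle hGle
    _ = _ := by rw [← add_mul]; norm_num

theorem sq_lintegral_eq_lintegral_lintegral {Y : Type*} [MeasurableSpace Y] (ρ : Measure Y)
    {F : Y → ℝ≥0∞} (hF : Measurable F) :
    (∫⁻ y, F y ∂ρ) ^ 2 = ∫⁻ y, ∫⁻ z, F y * F z ∂ρ ∂ρ := by
  simp_rw [lintegral_const_mul _ hF]
  rw [lintegral_mul_const _ hF, sq]

variable {X : Type*} [MeasurableSpace X] {ν : Measure X} [SFinite ν]

/-- An integral operator `L²(0, ∞) → L²(ν)` whose Gram kernel is dominated by `C / (x + y)` is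
bounded. -/
theorem lintegral_sq_kernel_le {k : X → ℝ → ℝ≥0∞} (hk : Measurable (Function.uncurry k))
    {C : ℝ≥0∞} (hC : ∀ x > 0, ∀ y > 0, ∫⁻ t, k t x * k t y ∂ν ≤ C * ENNReal.ofReal (1 / (x + y)))
    {g : ℝ → ℝ≥0∞} (hg : Measurable g) :
    ∫⁻ t, (∫⁻ x in Ioi (0 : ℝ), k t x * g x) ^ 2 ∂ν ≤ 8 * C * ∫⁻ x in Ioi (0 : ℝ), g x ^ 2 := by
  have hk1 : ∀ x, Measurable fun t => k t x := fun x => hk.comp measurable_prodMk_right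
  have hk2 : ∀ t, Measurable (k t) := fun t => hk.comp measurable_prodMk_left
  have hkc : ∀ {Z : Type _} [MeasurableSpace Z] {a : Z → X} {b : Z → ℝ}, Measurable a →
      Measurable b → Measurable fun z => k (a z) (b z) := fun ha hb => hk.comp (ha.prodMk hb)
  -- Expand the square and integrate over `t` first by Tonelli: only the Gram kernel remains, to
  -- which Hilbert's inequality applies.
  calc _ = ∫⁻ t, (∫⁻ x in Ioi (0 : ℝ), ∫⁻ y in Ioi (0 : ℝ), k t x * g x * (k t y * g y)) ∂ν :=
        lintegral_congr fun t => sq_lintegral_eq_lintegral_lintegral _ ((hk2 t).mul hg)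
    _ = ∫⁻ x in Ioi (0 : ℝ), ∫⁻ y in Ioi (0 : ℝ), (∫⁻ t, k t x * g x * (k t y * g y) ∂ν) := by
        rw [lintegral_lintegral_swap]
        · refine lintegral_congr fun x => lintegral_lintegral_swap ?_
          refine Measurable.aemeasurable ?_
          refine Measurable.mul (Measurable.mul ?_ measurable_const) (Measurable.mul ?_ ?_)
          · exact hkc measurable_fst measurable_const
          · exact hkc measurable_fst measurable_snd
          · exact hg.comp measurable_snd
        · refine Measurable.aemeasurable (Measurable.lintegral_prod_right' (f := fun q : (X × ℝ) × ℝ =>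
            k q.1.1 q.1.2 * g q.1.2 * (k q.1.1 q.2 * g q.2)) ?_)
          refine Measurable.mul (Measurable.mul ?_ ?_) (Measurable.mul ?_ ?_)
          · exact hkc (by fun_prop) (by fun_prop)
          · fun_prop
          · exact hkc (by fun_prop) (by fun_prop)
          · fun_prop
    _ ≤ ∫⁻ x in Ioi (0 : ℝ), ∫⁻ y in Ioi (0 : ℝ), C * (g x * g y * ENNReal.ofReal (1 / (x + y))) := by
        refine setLIntegral_mono' measurableSet_Ioi fun x hx => ?_
        refine setLIntegral_mono' measurableSet_Ioi fun y hy => ?_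
        calc _ = ∫⁻ t, (g x * g y) * (k t x * k t y) ∂ν := by
              refine lintegral_congr fun t => by ring
          _ = (g x * g y) * ∫⁻ t, (k t x * k t y) ∂ν :=
              lintegral_const_mul _ ((hk1 x).mul (hk1 y))
          _ ≤ (g x * g y) * (C * ENNReal.ofReal (1 / (x + y))) := by
              gcongr
              exact hC x hx y hy
          _ = _ := by ring
    _ = C * ∫⁻ x in Ioi (0 : ℝ), ∫⁻ y in Ioi (0 : ℝ), g x * g y * ENNReal.ofReal (1 / (x + y)) := by
        rw [← lintegral_const_mul]
        · refine lintegral_congr fun x => lintegral_const_mul _ (by fun_prop)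
        · refine Measurable.lintegral_prod_right' (f := fun q : ℝ × ℝ =>
            g q.1 * g q.2 * ENNReal.ofReal (1 / (q.1 + q.2))) (by fun_prop)
    _ ≤ C * (8 * ∫⁻ x in Ioi (0 : ℝ), g x ^ 2) := by
        gcongr
        exact lintegral_lintegral_hilbert_kernel_le hg
    _ = _ := by ring

end HilbertInequality

/-! ### Bounded integral operators and their Gram kernels. -/

section KernelOperator

open Set
open scoped ENNReal NNReal ComplexConjugate

variable {X : Type*} [MeasurableSpace X] {ν : Measure X}

theorem eLpNorm_two_sq_eq_lintegral (f : X → ℂ) :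
    eLpNorm f 2 ν ^ 2 = ∫⁻ t, ‖f t‖ₑ ^ 2 ∂ν := by
  have := eLpNorm_nnreal_pow_eq_lintegral (f := f) (μ := ν) (p := 2) two_ne_zero
  simpa only [ENNReal.coe_ofNat, NNReal.coe_ofNat, ENNReal.rpow_two] using this

/-- `T` is the integral operator `L²(0, ∞) → L²(ν)` with kernel `k`. -/
def IsKernelOperator (k : X → ℝ → ℝ) (T : LTwoIoi 0 →L[ℂ] Lp ℂ 2 ν) : Prop :=
  ∀ f : LTwoIoi 0, ∀ᵐ t ∂ν, IntegrableOn (fun x => (k t x : ℂ) * f x) (Ioi 0) ∧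
    T f t = ∫ x in Ioi (0 : ℝ), (k t x : ℂ) * f x

/-- The Gram kernel `∫ |k(t, x) k(t, y)| dν(t)` is dominated by the Carleman kernel. -/
def GramDominated (ν : Measure X) (k : X → ℝ → ℝ) (C : ℝ≥0) : Prop :=
  ∀ x > 0, ∀ y > 0, ∫⁻ t, ‖k t x‖ₑ * ‖k t y‖ₑ ∂ν ≤ C * ENNReal.ofReal (1 / (x + y))

variable {k : X → ℝ → ℝ} {C : ℝ≥0}

theorem GramDominated.lintegral_sq_le [SFinite ν] (hC : GramDominated ν k C)
    (hk : Measurable (Function.uncurry k)) (f : LTwoIoi 0) :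
    ∫⁻ t, (∫⁻ x in Ioi (0 : ℝ), ‖(k t x : ℂ) * f x‖ₑ) ^ 2 ∂ν ≤
      8 * C * eLpNorm f 2 (volume.restrict (Ioi 0)) ^ 2 := by
  rw [eLpNorm_two_sq_eq_lintegral]
  have h := lintegral_sq_kernel_le (ν := ν) (k := fun t x => ‖k t x‖ₑ) hk.enorm
    (C := C) hC (g := fun x => ‖f x‖ₑ) (Lp.stronglyMeasurable f).measurable.enorm
  have e : ∀ r : ℝ, ‖(r : ℂ)‖ₑ = ‖r‖ₑ := fun r => by
    rw [← ofReal_norm, ← ofReal_norm, Complex.norm_real]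
  simpa only [enorm_mul, e] using h

theorem GramDominated.ae_integrableOn [SFinite ν] (hC : GramDominated ν k C)
    (hk : Measurable (Function.uncurry k)) (f : LTwoIoi 0) :
    ∀ᵐ t ∂ν, IntegrableOn (fun x => (k t x : ℂ) * f x) (Ioi 0) := by
  have hf := (Lp.stronglyMeasurable f).measurable
  have hm : Measurable fun q : X × ℝ => ‖(k q.1 q.2 : ℂ) * f q.2‖ₑ :=
    ((Complex.measurable_ofReal.comp hk).mul (hf.comp measurable_snd)).enorm
  have h := hC.lintegral_sq_le hk f
  have hlt : ∫⁻ t, (∫⁻ x in Ioi (0 : ℝ), ‖(k t x : ℂ) * f x‖ₑ) ^ 2 ∂ν ≠ ∞ := by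
    refine (h.trans_lt ?_).ne
    exact ENNReal.mul_lt_top (ENNReal.mul_lt_top (by simp) ENNReal.coe_lt_top)
      (ENNReal.pow_lt_top (Lp.eLpNorm_lt_top f))
  filter_upwards [ae_lt_top (hm.lintegral_prod_right'.pow_const 2) hlt] with t ht
  refine ⟨?_, ?_⟩
  · exact ((Complex.measurable_ofReal.comp (hk.comp measurable_prodMk_left)).mul
      hf).aestronglyMeasurable
  · exact (ENNReal.pow_lt_top_iff.1 ht).resolve_right two_ne_zero

theorem GramDominated.eLpNorm_integral_le [SFinite ν] (hC : GramDominated ν k C)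
    (hk : Measurable (Function.uncurry k)) (f : LTwoIoi 0) :
    eLpNorm (fun t => ∫ x in Ioi (0 : ℝ), (k t x : ℂ) * f x) 2 ν ≤
      (8 * C + 1 : ℝ≥0) * eLpNorm f 2 (volume.restrict (Ioi 0)) := by
  have h1 : eLpNorm (fun t => ∫ x in Ioi (0 : ℝ), (k t x : ℂ) * f x) 2 ν ^ 2 ≤
      8 * C * eLpNorm f 2 (volume.restrict (Ioi 0)) ^ 2 := by
    rw [eLpNorm_two_sq_eq_lintegral]
    refine le_trans (lintegral_mono fun t => ?_) (hC.lintegral_sq_le hk f)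
    gcongr
    exact enorm_integral_le_lintegral_enorm _
  -- A non-optimal constant: `8C + 1` stands in for the square root of `8C`.
  have h2 : (8 * C : ℝ≥0∞) ≤ ((8 * C + 1 : ℝ≥0) : ℝ≥0∞) ^ 2 := by
    have : (8 * C : ℝ≥0) ≤ (8 * C + 1) ^ 2 := by
      calc (8 * C : ℝ≥0) ≤ 8 * C + 1 := le_self_add
        _ ≤ (8 * C + 1) ^ 2 := le_self_pow₀ le_add_self two_ne_zero
    exact_mod_cast this
  refine (ENNReal.pow_le_pow_left_iff two_ne_zero).1 (h1.trans ?_)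
  rw [mul_pow]
  gcongr

theorem GramDominated.memLp_integral [SFinite ν] (hC : GramDominated ν k C)
    (hk : Measurable (Function.uncurry k)) (f : LTwoIoi 0) :
    MemLp (fun t => ∫ x in Ioi (0 : ℝ), (k t x : ℂ) * f x) 2 ν := by
  refine ⟨?_, (hC.eLpNorm_integral_le hk f).trans_lt
    (ENNReal.mul_lt_top ENNReal.coe_lt_top (Lp.eLpNorm_lt_top f))⟩
  have hf := (Lp.stronglyMeasurable f).measurable
  have hm : Measurable fun q : X × ℝ => (k q.1 q.2 : ℂ) * f q.2 :=
    (Complex.measurable_ofReal.comp hk).mul (hf.comp measurable_snd)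
  exact hm.stronglyMeasurable.integral_prod_right'.aestronglyMeasurable

theorem GramDominated.exists_isKernelOperator [SFinite ν] (hC : GramDominated ν k C)
    (hk : Measurable (Function.uncurry k)) :
    ∃ T : LTwoIoi 0 →L[ℂ] Lp ℂ 2 ν, IsKernelOperator k T := by
  let L : LTwoIoi 0 →ₗ[ℂ] Lp ℂ 2 ν :=
    { toFun := fun f => (hC.memLp_integral hk f).toLp _
      map_add' := fun f g => by
        rw [← MemLp.toLp_add, MemLp.toLp_eq_toLp_iff]
        filter_upwards [hC.ae_integrableOn hk f, hC.ae_integrableOn hk g] with t hf hg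
        rw [Pi.add_apply, ← integral_add hf hg]
        refine integral_congr_ae ?_
        filter_upwards [Lp.coeFn_add f g] with x hx
        rw [hx, Pi.add_apply, mul_add]
      map_smul' := fun c f => by
        rw [RingHom.id_apply, ← MemLp.toLp_const_smul, MemLp.toLp_eq_toLp_iff]
        refine Filter.Eventually.of_forall fun t => ?_
        rw [Pi.smul_apply, smul_eq_mul, ← integral_const_mul]
        refine integral_congr_ae ?_
        filter_upwards [Lp.coeFn_smul c f] with x hx
        rw [hx, Pi.smul_apply, smul_eq_mul]
        ring }
  refine ⟨L.mkContinuous (8 * C + 1 : ℝ≥0) fun f => ?_, fun f => ?_⟩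
  · change ‖(hC.memLp_integral hk f).toLp _‖ ≤ _
    rw [Lp.norm_toLp, Lp.norm_def, ← ENNReal.coe_toReal, ← ENNReal.toReal_mul]
    exact ENNReal.toReal_mono (ENNReal.mul_lt_top ENNReal.coe_lt_top (Lp.eLpNorm_lt_top f)).ne
      (hC.eLpNorm_integral_le hk f)
  · filter_upwards [hC.ae_integrableOn hk f, (hC.memLp_integral hk f).coeFn_toLp] with t h1 h2
    exact ⟨h1, h2⟩

/-- Justifies Fubini in the computation of `⟨T f, T g⟩`. After integrating out both variables, the
absolute value is a product of two functions of `t`, each square integrable by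
`GramDominated.lintegral_sq_le`. -/
theorem GramDominated.integrable_prod [SFinite ν] (hC : GramDominated ν k C)
    (hk : Measurable (Function.uncurry k)) (f g : LTwoIoi 0) :
    Integrable (fun q : X × (ℝ × ℝ) => conj ((k q.1 q.2.1 : ℂ) * f q.2.1) *
      ((k q.1 q.2.2 : ℂ) * g q.2.2))
      (ν.prod ((volume.restrict (Ioi 0)).prod (volume.restrict (Ioi 0)))) := by
  have hm : ∀ f : LTwoIoi 0, Measurable fun q : X × ℝ => (k q.1 q.2 : ℂ) * f q.2 := fun f =>
    (Complex.measurable_ofReal.comp hk).mul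
      ((Lp.stronglyMeasurable f).measurable.comp measurable_snd)
  have hmf : Measurable fun q : X × (ℝ × ℝ) => (k q.1 q.2.1 : ℂ) * f q.2.1 :=
    (hm f).comp (by fun_prop : Measurable fun q : X × (ℝ × ℝ) => (q.1, q.2.1))
  have hmg : Measurable fun q : X × (ℝ × ℝ) => (k q.1 q.2.2 : ℂ) * g q.2.2 :=
    (hm g).comp (by fun_prop : Measurable fun q : X × (ℝ × ℝ) => (q.1, q.2.2))
  have hmeas : Measurable (fun q : X × (ℝ × ℝ) => conj ((k q.1 q.2.1 : ℂ) * f q.2.1) *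
      ((k q.1 q.2.2 : ℂ) * g q.2.2)) := (Complex.continuous_conj.measurable.comp hmf).mul hmg
  refine ⟨hmeas.aestronglyMeasurable, ?_⟩
  have hfin : ∀ f : LTwoIoi 0,
      ∫⁻ t, (∫⁻ x in Ioi (0 : ℝ), ‖(k t x : ℂ) * f x‖ₑ) ^ 2 ∂ν < ∞ := fun f =>
    (hC.lintegral_sq_le hk f).trans_lt (ENNReal.mul_lt_top (ENNReal.mul_lt_top (by simp)
      ENNReal.coe_lt_top) (ENNReal.pow_lt_top (Lp.eLpNorm_lt_top f)))
  rw [HasFiniteIntegral, lintegral_prod _ hmeas.enorm.aemeasurable]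
  calc _ = ∫⁻ t, (∫⁻ x in Ioi (0 : ℝ), ‖(k t x : ℂ) * f x‖ₑ) *
        (∫⁻ x in Ioi (0 : ℝ), ‖(k t x : ℂ) * g x‖ₑ) ∂ν := by
        refine lintegral_congr fun t => ?_
        rw [← lintegral_prod_mul]
        · refine lintegral_congr fun q => ?_
          rw [enorm_mul, RCLike.enorm_conj]
        · exact ((hm f).comp measurable_prodMk_left).enorm.aemeasurable
        · exact ((hm g).comp measurable_prodMk_left).enorm.aemeasurable
    _ ≤ ∫⁻ t, ((∫⁻ x in Ioi (0 : ℝ), ‖(k t x : ℂ) * f x‖ₑ) ^ 2 +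
        (∫⁻ x in Ioi (0 : ℝ), ‖(k t x : ℂ) * g x‖ₑ) ^ 2) ∂ν :=
        lintegral_mono fun t => ENNReal.mul_le_sq_add_sq _ _
    _ = _ := lintegral_add_left ((hm f).enorm.lintegral_prod_right'.pow_const 2) _
    _ < ∞ := ENNReal.add_lt_top.2 ⟨hfin f, hfin g⟩

/-- The quadratic form of `T* T` is given by the Gram kernel. -/
theorem IsKernelOperator.inner_eq [SFinite ν] {T : LTwoIoi 0 →L[ℂ] Lp ℂ 2 ν}
    (hT : IsKernelOperator k T)
    (hC : GramDominated ν k C) (hk : Measurable (Function.uncurry k)) (f g : LTwoIoi 0) :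
    Integrable (fun q : ℝ × ℝ => conj (f q.1) * g q.2 * ((∫ t, k t q.1 * k t q.2 ∂ν : ℝ) : ℂ))
      ((volume.restrict (Ioi 0)).prod (volume.restrict (Ioi 0))) ∧
    inner ℂ (T f) (T g) = ∫ q : ℝ × ℝ, conj (f q.1) * g q.2 * ((∫ t, k t q.1 * k t q.2 ∂ν : ℝ) : ℂ)
      ∂((volume.restrict (Ioi 0)).prod (volume.restrict (Ioi 0))) := by
  have hInt := hC.integrable_prod hk f g
  have e : ∀ q : ℝ × ℝ, ∫ t, conj ((k t q.1 : ℂ) * f q.1) * ((k t q.2 : ℂ) * g q.2) ∂ν =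
      conj (f q.1) * g q.2 * ((∫ t, k t q.1 * k t q.2 ∂ν : ℝ) : ℂ) := by
    intro q
    rw [← integral_complex_ofReal, ← integral_const_mul]
    refine integral_congr_ae (Filter.Eventually.of_forall fun t => ?_)
    simp only [map_mul, Complex.conj_ofReal]
    push_cast
    ring
  constructor
  · exact hInt.integral_prod_right.congr (Filter.Eventually.of_forall e)
  · rw [L2.inner_def]
    calc _ = ∫ t, (∫ q : ℝ × ℝ, conj ((k t q.1 : ℂ) * f q.1) * ((k t q.2 : ℂ) * g q.2)
          ∂((volume.restrict (Ioi 0)).prod (volume.restrict (Ioi 0)))) ∂ν := by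
          refine integral_congr_ae ?_
          filter_upwards [hT f, hT g] with t h1 h2
          rw [h1.2, h2.2, RCLike.inner_apply, mul_comm, ← integral_conj]
          exact (integral_prod_mul (fun x => conj ((k t x : ℂ) * f x))
            (fun x => (k t x : ℂ) * g x)).symm
      _ = _ := by
          rw [integral_integral_swap hInt]
          exact integral_congr_ae (Filter.Eventually.of_forall e)

/-- Evaluation of an integral operator is the inner product with a slice of its kernel. -/
theorem integral_ofReal_mul_eq_inner {κ : ℝ → ℝ} (hκ : MemLp (fun x => (κ x : ℂ)) 2
    (volume.restrict (Ioi 0))) (f : LTwoIoi 0) :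
    ∫ x in Ioi (0 : ℝ), (κ x : ℂ) * f x = inner ℂ (hκ.toLp _) f := by
  rw [L2.inner_def]
  refine integral_congr_ae ?_
  filter_upwards [hκ.coeFn_toLp] with x hx
  rw [hx, RCLike.inner_apply, Complex.conj_ofReal, mul_comm]

/-- Since `(T T* u)(t)` is the inner product of the slice `k(t, ·)` with `T* u`, moving `T` across
leaves `T` applied to the slice: this computes the kernel of `T T*`. -/
theorem IsKernelOperator.slice_ae_eq {T : LTwoIoi 0 →L[ℂ] Lp ℂ 2 ν} (hT : IsKernelOperator k T)
    {t : X} (ht : MemLp (fun x => (k t x : ℂ)) 2 (volume.restrict (Ioi 0))) :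
    ∀ᵐ s ∂ν, T (ht.toLp _) s = ((∫ x in Ioi (0 : ℝ), k s x * k t x : ℝ) : ℂ) := by
  filter_upwards [hT (ht.toLp _)] with s hs
  rw [hs.2, ← integral_complex_ofReal]
  refine integral_congr_ae ?_
  filter_upwards [ht.coeFn_toLp] with x hx
  rw [hx]
  push_cast
  rfl

end KernelOperator

/-! ### Square-integrable functions for counting measure as `ℓ²` sequences. -/

section CountingMeasure

variable {ι : Type*} [MeasurableSpace ι] [DiscreteMeasurableSpace ι] [Countable ι]

theorem memℓp_two_of_Lp_count (f : Lp ℂ 2 (Measure.count : Measure ι)) :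
    Memℓp (fun i => f i) 2 := by
  refine memℓp_gen ?_
  have h := (memLp_two_iff_integrable_sq_norm (Lp.aestronglyMeasurable f)).1 (Lp.memLp f)
  have h2 := integrable_count_iff.1 h
  simpa using h2

theorem integral_count_eq_tsum {E : Type*} [NormedAddCommGroup E] [NormedSpace ℝ E]
    [CompleteSpace E] {f : ι → E} (hf : Integrable f Measure.count) :
    ∫ i, f i ∂Measure.count = ∑' i, f i := by
  rw [integral_countable hf]
  simp [Measure.real]

/-- The isometric embedding of `L²` of the counting measure into `ℓ²`. -/
noncomputable def lpOfLpCount :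
    Lp ℂ 2 (Measure.count : Measure ι) →ₗᵢ[ℂ] lp (fun _ : ι => ℂ) 2 :=
  LinearMap.isometryOfInner
    { toFun := fun f => ⟨fun i => f i, memℓp_two_of_Lp_count f⟩
      map_add' := fun f g => by
        ext i
        exact Measure.ae_count_iff.1 (Lp.coeFn_add f g) i
      map_smul' := fun c f => by
        ext i
        exact Measure.ae_count_iff.1 (Lp.coeFn_smul c f) i }
    fun f g => by
      rw [L2.inner_def, integral_count_eq_tsum (L2.integrable_inner f g)]
      rfl

end CountingMeasure

/-! ### Entire functions of `x + y` as kernels: Schatten class membership. -/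

section EntireKernel

open Set
open scoped ENNReal NNReal ComplexConjugate

/-- A bounded non-negative measurable weight supported in `(0, R]`. -/
structure IsWeight (v : ℝ → ℝ) (D R : ℝ) : Prop where
  measurable : Measurable v
  nonneg : ∀ x, 0 ≤ v x
  le : ∀ x, v x ≤ D
  pos_R : 0 < R
  support : ∀ x, v x ≠ 0 → 0 < x ∧ x ≤ R

variable {v : ℝ → ℝ} {D R : ℝ}

theorem IsWeight.memLp_mul (hv : IsWeight v D R) {h : ℝ → ℝ} (hh : Measurable h) {c : ℝ}
    (hc : ∀ x, 0 < x → x ≤ R → |h x| ≤ c) :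
    MemLp (fun x => h x * v x) 2 (volume.restrict (Ioi 0)) := by
  have h1 : MemLp ((Ioc 0 R).indicator fun _ => c * D) 2 (volume.restrict (Ioi (0 : ℝ))) :=
    memLp_indicator_const 2 measurableSet_Ioc _ (Or.inr (by
      refine ((Measure.restrict_apply_le _ _).trans_lt ?_).ne
      simp))
  refine h1.mono (hh.mul hv.measurable).aestronglyMeasurable
    (Filter.Eventually.of_forall fun x => ?_)
  by_cases hx : v x = 0
  · simp [hx]
  · obtain ⟨h0, hR⟩ := hv.support x hx
    rw [indicator_of_mem (show x ∈ Ioc 0 R from ⟨h0, hR⟩), norm_mul, Real.norm_eq_abs,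
      Real.norm_of_nonneg (hv.nonneg x)]
    refine le_trans ?_ (le_abs_self _)
    exact mul_le_mul (hc x h0 hR) (hv.le x) (hv.nonneg x) ((abs_nonneg _).trans (hc x h0 hR))

theorem IsWeight.memLp_pow_mul (hv : IsWeight v D R) (i : ℕ) :
    MemLp (fun x => ((x ^ i * v x : ℝ) : ℂ)) 2 (volume.restrict (Ioi 0)) :=
  (hv.memLp_mul (h := fun x => x ^ i) (by fun_prop) (c := R ^ i) fun x h0 hR => by
    rw [abs_of_nonneg (by positivity)]
    gcongr).ofReal

/-- The function `x ^ i * v x` as an element of `L²(0, ∞)`. -/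
noncomputable def IsWeight.monomial (hv : IsWeight v D R) (i : ℕ) : LTwoIoi 0 :=
  (hv.memLp_pow_mul i).toLp _

theorem IsWeight.inner_monomial_left (hv : IsWeight v D R) (i : ℕ) (f : LTwoIoi 0) :
    inner ℂ (hv.monomial i) f = ∫ x in Ioi (0 : ℝ), ((x ^ i * v x : ℝ) : ℂ) * f x :=
  (integral_ofReal_mul_eq_inner (hv.memLp_pow_mul i) f).symm

theorem IsWeight.integrable_monomial_mul (hv : IsWeight v D R) (i : ℕ) (f : LTwoIoi 0) :
    Integrable (fun x => ((x ^ i * v x : ℝ) : ℂ) * f x) (volume.restrict (Ioi 0)) :=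
  (hv.memLp_pow_mul i).integrable_mul (Lp.memLp f)

theorem IsWeight.integrable_conj_mul (hv : IsWeight v D R) (i : ℕ) (f : LTwoIoi 0) :
    Integrable (fun x => conj (f x) * ((x ^ i * v x : ℝ) : ℂ)) (volume.restrict (Ioi 0)) := by
  refine ((LinearIsometryEquiv.integrable_comp_iff (Complex.conjLIE)).2
    (hv.integrable_monomial_mul i f)).congr (Filter.Eventually.of_forall fun x => ?_)
  simp [mul_comm]

theorem IsWeight.inner_monomial_right (hv : IsWeight v D R) (i : ℕ) (f : LTwoIoi 0) :
    inner ℂ f (hv.monomial i) = ∫ x in Ioi (0 : ℝ), conj (f x) * ((x ^ i * v x : ℝ) : ℂ) := by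
  rw [← inner_conj_symm, hv.inner_monomial_left, ← integral_conj]
  refine integral_congr_ae (Filter.Eventually.of_forall fun x => ?_)
  simp only [map_mul, Complex.conj_ofReal]
  ring

/-- Cauchy–Schwarz: `monomial 0` is `v` itself, and `|f|` has the same norm as `f`. -/
theorem IsWeight.integral_norm_mul_le (hv : IsWeight v D R) (f : LTwoIoi 0) :
    ∫ x in Ioi (0 : ℝ), ‖f x‖ * v x ≤ ‖f‖ * ‖hv.monomial 0‖ := by
  have hf : MemLp (fun x => (‖f x‖ : ℂ)) 2 (volume.restrict (Ioi 0)) := (Lp.memLp f).norm.ofReal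
  have h1 : inner ℂ (hf.toLp _) (hv.monomial 0) =
      ((∫ x in Ioi (0 : ℝ), ‖f x‖ * v x : ℝ) : ℂ) := by
    rw [hv.inner_monomial_right, ← integral_complex_ofReal]
    refine integral_congr_ae ?_
    filter_upwards [hf.coeFn_toLp] with x hx
    rw [hx]
    simp
  have h2 : ‖hf.toLp _‖ = ‖f‖ := by
    rw [Lp.norm_toLp, Lp.norm_def]
    congr 1
    refine eLpNorm_congr_norm_ae (Filter.Eventually.of_forall fun x => ?_)
    simp
  have h3 := norm_inner_le_norm (𝕜 := ℂ) (hf.toLp _) (hv.monomial 0)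
  rw [h1, h2, Complex.norm_real] at h3
  exact (le_abs_self _).trans h3

/-- The finite-rank operator with kernel `v x * v y * ∑ m < n, c m * (x + y) ^ m`. -/
noncomputable def IsWeight.truncation (hv : IsWeight v D R) (c : ℕ → ℂ) (n : ℕ) :
    LTwoIoi 0 →L[ℂ] LTwoIoi 0 :=
  ∑ m ∈ Finset.range n, ∑ i ∈ Finset.range (m + 1),
    (c m * (m.choose i : ℂ)) • InnerProductSpace.rankOne ℂ (hv.monomial i) (hv.monomial (m - i))

theorem IsWeight.truncation_mem_span (hv : IsWeight v D R) (c : ℕ → ℂ) (n : ℕ) (f : LTwoIoi 0) :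
    hv.truncation c n f ∈ Submodule.span ℂ (range fun i : Fin n => hv.monomial i) := by
  simp only [IsWeight.truncation, sum_apply, smul_apply,
    InnerProductSpace.rankOne_apply]
  refine Submodule.sum_mem _ fun m hm => Submodule.sum_mem _ fun i hi => ?_
  refine Submodule.smul_mem _ _ (Submodule.smul_mem _ _ (Submodule.subset_span ?_))
  rw [Finset.mem_range] at hm hi
  exact ⟨⟨i, by omega⟩, rfl⟩

/-- The binomial theorem separates the variables in `(x+y)^m`, so each double integral is a product
of two inner products with monomials. -/
theorem IsWeight.inner_truncation (hv : IsWeight v D R) (c : ℕ → ℂ) (n : ℕ) (f g : LTwoIoi 0) :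
    Integrable (fun q : ℝ × ℝ => conj (f q.1) * g q.2 *
        (v q.1 * v q.2 * ∑ m ∈ Finset.range n, c m * ((q.1 + q.2 : ℝ) : ℂ) ^ m))
      ((volume.restrict (Ioi 0)).prod (volume.restrict (Ioi 0))) ∧
    inner ℂ f (hv.truncation c n g) = ∫ q : ℝ × ℝ, conj (f q.1) * g q.2 *
        (v q.1 * v q.2 * ∑ m ∈ Finset.range n, c m * ((q.1 + q.2 : ℝ) : ℂ) ^ m)
      ∂((volume.restrict (Ioi 0)).prod (volume.restrict (Ioi 0))) := by
  have hInt : ∀ m i : ℕ, Integrable (fun q : ℝ × ℝ => (c m * (m.choose i : ℂ)) *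
      ((conj (f q.1) * ((q.1 ^ i * v q.1 : ℝ) : ℂ)) *
        (((q.2 ^ (m - i) * v q.2 : ℝ) : ℂ) * g q.2)))
      ((volume.restrict (Ioi 0)).prod (volume.restrict (Ioi 0))) := fun m i =>
    ((hv.integrable_conj_mul i f).mul_prod (hv.integrable_monomial_mul (m - i) g)).const_mul _
  have e : ∀ q : ℝ × ℝ, conj (f q.1) * g q.2 *
        (v q.1 * v q.2 * ∑ m ∈ Finset.range n, c m * ((q.1 + q.2 : ℝ) : ℂ) ^ m) =
      ∑ m ∈ Finset.range n, ∑ i ∈ Finset.range (m + 1), (c m * (m.choose i : ℂ)) *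
      ((conj (f q.1) * ((q.1 ^ i * v q.1 : ℝ) : ℂ)) *
        (((q.2 ^ (m - i) * v q.2 : ℝ) : ℂ) * g q.2)) := by
    intro q
    push_cast
    simp_rw [add_pow, Finset.mul_sum]
    refine Finset.sum_congr rfl fun m _ => Finset.sum_congr rfl fun i _ => ?_
    ring
  simp_rw [e]
  have hInt' : ∀ m ∈ Finset.range n, Integrable (fun q : ℝ × ℝ =>
      ∑ i ∈ Finset.range (m + 1), (c m * (m.choose i : ℂ)) *
      ((conj (f q.1) * ((q.1 ^ i * v q.1 : ℝ) : ℂ)) *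
        (((q.2 ^ (m - i) * v q.2 : ℝ) : ℂ) * g q.2)))
      ((volume.restrict (Ioi 0)).prod (volume.restrict (Ioi 0))) := fun m _ =>
    integrable_finsetSum _ fun i _ => hInt m i
  refine ⟨integrable_finsetSum _ hInt', ?_⟩
  rw [integral_finsetSum _ hInt', IsWeight.truncation, sum_apply, inner_sum]
  refine Finset.sum_congr rfl fun m _ => ?_
  rw [integral_finsetSum _ fun i _ => hInt m i, sum_apply, inner_sum]
  refine Finset.sum_congr rfl fun i _ => ?_
  rw [integral_const_mul, integral_prod_mul (fun x => conj (f x) * ((x ^ i * v x : ℝ) : ℂ))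
    (fun x => ((x ^ (m - i) * v x : ℝ) : ℂ) * g x), smul_apply,
    InnerProductSpace.rankOne_apply, inner_smul_right, inner_smul_right, hv.inner_monomial_left,
    hv.inner_monomial_right]
  ring

theorem opNorm_le_of_norm_inner_le {H : Type*} [NormedAddCommGroup H] [InnerProductSpace ℂ H]
    (T : H →L[ℂ] H) {M : ℝ} (hM : 0 ≤ M) (h : ∀ f g, ‖inner ℂ f (T g)‖ ≤ M * ‖f‖ * ‖g‖) :
    ‖T‖ ≤ M := by
  refine T.opNorm_le_bound hM fun g => ?_
  rcases eq_or_ne (T g) 0 with h0 | h0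
  · rw [h0, norm_zero]; positivity
  · have h1 := h (T g) g
    rw [inner_self_eq_norm_sq_to_K] at h1
    have h2 : ‖T g‖ * ‖T g‖ ≤ ‖T g‖ * (M * ‖g‖) := by
      calc ‖T g‖ * ‖T g‖ = ‖((‖T g‖ : ℂ) ^ 2)‖ := by simp [sq]
        _ ≤ _ := h1
        _ = _ := by ring
    exact le_of_mul_le_mul_left h2 (norm_pos_iff.2 h0)

/-- An integral operator with kernel `v x * v y * K (x + y)`, `K` entire, is in `S_0`. -/
theorem IsWeight.memSchattenZero_of_entire (hv : IsWeight v D R) {K : ℂ → ℂ}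
    (hK : Differentiable ℂ K) (T : LTwoIoi 0 →L[ℂ] LTwoIoi 0)
    (hT : ∀ f g : LTwoIoi 0, Integrable (fun q : ℝ × ℝ => conj (f q.1) * g q.2 *
        (v q.1 * v q.2 * K ((q.1 + q.2 : ℝ) : ℂ)))
        ((volume.restrict (Ioi 0)).prod (volume.restrict (Ioi 0))) ∧
      inner ℂ f (T g) = ∫ q : ℝ × ℝ, conj (f q.1) * g q.2 *
        (v q.1 * v q.2 * K ((q.1 + q.2 : ℝ) : ℂ))
        ∂((volume.restrict (Ioi 0)).prod (volume.restrict (Ioi 0)))) :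
    MemSchattenZero T := by
  have hR := hv.pos_R
  -- Where `v x * v y ≠ 0`, the argument `x + y` lies in `(0, 2R]`.
  obtain ⟨c, C, hcC⟩ := exists_taylor_geometric hK (2 * R) (by positivity)
  have hC0 : ∀ n, 0 ≤ C * (1 / 2) ^ n := fun n =>
    (norm_nonneg _).trans (hcC n 0 (by rw [norm_zero]; positivity))
  have := fun n => FiniteDimensional.span_of_finite ℂ (finite_range fun i : Fin n => hv.monomial i)
  refine memSchattenZero_of_geometric_approx T (hv.truncation c)
    (fun n => Submodule.span ℂ (range fun i : Fin n => hv.monomial i))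
    (fun n => ?_) (fun n f => hv.truncation_mem_span c n f) (C * ‖hv.monomial 0‖ ^ 2) (1 / 2)
    (by norm_num) (by norm_num) fun n => ?_
  · simpa [Set.finrank] using finrank_range_le_card (R := ℂ) fun i : Fin n => hv.monomial i
  · refine opNorm_le_of_norm_inner_le _ ?_ fun f g => ?_
    · rw [mul_right_comm]
      exact mul_nonneg (hC0 n) (by positivity)
    · obtain ⟨i1, e1⟩ := hT f g
      obtain ⟨i2, e2⟩ := hv.inner_truncation c n f g
      rw [sub_apply, inner_sub_right, e1, e2, ← integral_sub i1 i2]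
      have hi : ∀ f : LTwoIoi 0, Integrable (fun x => ‖f x‖ * v x) (volume.restrict (Ioi 0)) :=
        fun f => (hv.integrable_monomial_mul 0 f).norm.congr
          (Filter.Eventually.of_forall fun x => by simp [abs_of_nonneg (hv.nonneg x), mul_comm])
      calc _ ≤ ∫ q : ℝ × ℝ, C * (1 / 2) ^ n * ((‖f q.1‖ * v q.1) * (‖g q.2‖ * v q.2))
            ∂((volume.restrict (Ioi 0)).prod (volume.restrict (Ioi 0))) := by
            refine norm_integral_le_of_norm_le (((hi f).mul_prod (hi g)).const_mul _)
              (Filter.Eventually.of_forall fun q => ?_)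
            rw [← mul_sub, ← mul_sub, norm_mul, norm_mul, norm_mul, norm_mul, RCLike.norm_conj,
              Complex.norm_real, Complex.norm_real, Real.norm_of_nonneg (hv.nonneg _),
              Real.norm_of_nonneg (hv.nonneg _)]
            rcases eq_or_ne (v q.1) 0 with h1 | h1
            · simp [h1]
            rcases eq_or_ne (v q.2) 0 with h2 | h2
            · simp [h2]
            have b1 := hv.support _ h1
            have b2 := hv.support _ h2
            have hb := hcC n ((q.1 + q.2 : ℝ) : ℂ) (by
              rw [Complex.norm_real, Real.norm_of_nonneg (by linarith)]; linarith)
            calc _ = (‖f q.1‖ * v q.1) * (‖g q.2‖ * v q.2) * ‖K ((q.1 + q.2 : ℝ) : ℂ) -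
                  ∑ m ∈ Finset.range n, c m * ((q.1 + q.2 : ℝ) : ℂ) ^ m‖ := by ring
              _ ≤ (‖f q.1‖ * v q.1) * (‖g q.2‖ * v q.2) * (C * (1 / 2) ^ n) := by
                  have := hv.nonneg q.1
                  have := hv.nonneg q.2
                  gcongr
              _ = _ := by ring
        _ = C * (1 / 2) ^ n * ((∫ x in Ioi (0 : ℝ), ‖f x‖ * v x) *
              ∫ x in Ioi (0 : ℝ), ‖g x‖ * v x) := by
            rw [integral_const_mul]
            congr 1
            exact integral_prod_mul (fun x => ‖f x‖ * v x) (fun x => ‖g x‖ * v x)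
        _ ≤ C * (1 / 2) ^ n * ((‖f‖ * ‖hv.monomial 0‖) * (‖g‖ * ‖hv.monomial 0‖)) := by
            refine mul_le_mul_of_nonneg_left ?_ (hC0 n)
            refine mul_le_mul (hv.integral_norm_mul_le f) (hv.integral_norm_mul_le g) ?_
              (by positivity)
            exact integral_nonneg fun x => mul_nonneg (norm_nonneg _) (hv.nonneg x)
        _ = _ := by ring

end EntireKernel

/-! ### The power kernel and its Gram kernels. -/

section PowerKernel

open Set
open scoped ENNReal NNReal ComplexConjugate

variable {X : Type*} {φ : X → ℝ} {v : ℝ → ℝ} {D R : ℝ}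

/-- The kernel `φ(t) ^ (-1/2 - x) * v(x)`. -/
noncomputable def powerKernel (φ : X → ℝ) (v : ℝ → ℝ) (t : X) (x : ℝ) : ℝ :=
  φ t ^ (-(1 / 2 : ℝ) - x) * v x

theorem measurable_powerKernel [MeasurableSpace X] (hφ : Measurable φ) (hv : Measurable v) :
    Measurable (Function.uncurry (powerKernel φ v)) := by
  unfold Function.uncurry powerKernel
  fun_prop

theorem IsWeight.memLp_powerKernel (hv : IsWeight v D R) {t : X} (ht : 1 ≤ φ t) :
    MemLp (fun x => (powerKernel φ v t x : ℂ)) 2 (volume.restrict (Ioi 0)) :=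
  (hv.memLp_mul (h := fun x => φ t ^ (-(1 / 2 : ℝ) - x)) (by fun_prop) (c := 1)
    fun x h0 _ => by
      rw [abs_of_nonneg (by positivity)]
      exact Real.rpow_le_one_of_one_le_of_nonpos ht (by linarith)).ofReal

theorem powerKernel_mul_powerKernel {t : X} (ht : 0 < φ t) (x y : ℝ) :
    powerKernel φ v t x * powerKernel φ v t y = v x * v y * φ t ^ (-1 - (x + y)) := by
  have : φ t ^ (-1 - (x + y)) = φ t ^ (-(1 / 2 : ℝ) - x) * φ t ^ (-(1 / 2 : ℝ) - y) := by
    rw [← Real.rpow_add ht]; congr 1; ring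
  rw [this, powerKernel, powerKernel]
  ring

/-- The factorisation behind `S S*` and `T T*`: integrating out the exponent variable recovers the
Helson kernel at the product. -/
theorem integral_powerKernel_mul_powerKernel {w : ℝ → ℝ}
    (hw : ∀ᵐ x ∂(volume.restrict (Ioi (0 : ℝ))), w x = v x ^ 2) {s t : X} (hs : 0 ≤ φ s)
    (ht : 0 ≤ φ t) :
    ∫ x in Ioi (0 : ℝ), powerKernel φ v s x * powerKernel φ v t x =
      helsonKernel w (φ t * φ s) := by
  refine integral_congr_ae ?_
  filter_upwards [hw] with x hx
  rw [hx, Real.mul_rpow ht hs, powerKernel, powerKernel]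
  ring

variable [MeasurableSpace X] {ν : Measure X}

theorem integral_gram_powerKernel (hφ : ∀ t, 0 < φ t) (x y : ℝ) :
    ∫ t, powerKernel φ v t x * powerKernel φ v t y ∂ν =
      v x * v y * ∫ t, φ t ^ (-1 - (x + y)) ∂ν := by
  simp_rw [fun t => powerKernel_mul_powerKernel (v := v) (hφ t) x y]
  rw [integral_const_mul]

/-- The bound by `c / s` is needed only for `s ≤ 2R`, since the Gram kernel vanishes unless both
variables lie in the support of `v`. -/
theorem IsWeight.gramDominated_powerKernel (hv : IsWeight v D R) (hφ : ∀ t, 0 < φ t) {c : ℝ}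
    (hInt : ∀ s : ℝ, 0 < s → Integrable (fun t => φ t ^ (-1 - s)) ν)
    (hc : ∀ s : ℝ, 0 < s → s ≤ 2 * R → ∫ t, φ t ^ (-1 - s) ∂ν ≤ c * (1 / s)) :
    GramDominated ν (powerKernel φ v) (D ^ 2 * c).toNNReal := by
  intro x hx y hy
  have hR := hv.pos_R
  have e : ∫⁻ t, ‖powerKernel φ v t x‖ₑ * ‖powerKernel φ v t y‖ₑ ∂ν =
      ENNReal.ofReal (v x * v y * ∫ t, φ t ^ (-1 - (x + y)) ∂ν) := by
    rw [← integral_const_mul, ofReal_integral_eq_lintegral_ofReal]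
    · refine lintegral_congr fun t => ?_
      have := hv.nonneg x
      have := hv.nonneg y
      have := hφ t
      rw [← enorm_mul, powerKernel_mul_powerKernel (hφ t), Real.enorm_of_nonneg (by positivity)]
    · exact (hInt _ (by linarith)).const_mul _
    · refine Filter.Eventually.of_forall fun t => ?_
      have := hv.nonneg x
      have := hv.nonneg y
      have := hφ t
      simp only [Pi.zero_apply]
      positivity
  rw [e]
  by_cases h : v x = 0 ∨ v y = 0
  · rcases h with h | h <;> simp [h]
  push Not at h
  have bx := hv.support x h.1
  have bY := hv.support y h.2
  have hD : 0 ≤ D := (hv.nonneg x).trans (hv.le x)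
  have hZ0 : 0 ≤ ∫ t, φ t ^ (-1 - (x + y)) ∂ν :=
    integral_nonneg fun t => Real.rpow_nonneg (hφ t).le _
  have hZ := hc (x + y) (by linarith) (by linarith)
  have hs : 0 ≤ 1 / (x + y) := by positivity
  calc _ ≤ ENNReal.ofReal (D ^ 2 * c * (1 / (x + y))) := by
        refine ENNReal.ofReal_le_ofReal ?_
        rw [mul_assoc (D ^ 2), sq]
        refine mul_le_mul ?_ hZ hZ0 (by positivity)
        exact mul_le_mul (hv.le x) (hv.le y) (hv.nonneg y) hD
    _ = _ := by
        rw [ENNReal.ofReal_mul' hs]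
        rfl

end PowerKernel

/-! ### Helson operators as `T T*`. -/

section Helson

open Set ContinuousLinearMap
open scoped ENNReal NNReal ComplexConjugate

/-- `ℕ+` with the discrete σ-algebra. -/
instance instMeasurableSpacePNat : MeasurableSpace ℕ+ := ⊤

instance instDiscreteMeasurableSpacePNat : DiscreteMeasurableSpace ℕ+ := ⟨fun _ => trivial⟩

variable {v w : ℝ → ℝ} {D R : ℝ}

theorem isIntegralHelsonOperator_of_isKernelOperator (hv : IsWeight v D R)
    (hw : ∀ᵐ x ∂(volume.restrict (Ioi (0 : ℝ))), w x = v x ^ 2)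
    {T : LTwoIoi 0 →L[ℂ] LTwoIoi 1}
    (hT : IsKernelOperator (powerKernel (fun t : ℝ => max t 1) v) T) :
    IsIntegralHelsonOperator (fun t : ℝ => (helsonKernel w t : ℂ)) (T ∘L adjoint T) := by
  intro u
  filter_upwards [hT (adjoint T u), ae_restrict_mem measurableSet_Ioi] with t ht ht1
  -- The base `max t 1` equals `t` on `(1, ∞)` and keeps it at least `1` for every real `t`.
  have hslice := hv.memLp_powerKernel (φ := fun t : ℝ => max t 1) (t := t) (le_max_right _ _)
  have hae : ∀ᵐ s ∂(volume.restrict (Ioi (1 : ℝ))),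
      inner ℂ (T (hslice.toLp _) s) (u s) = (helsonKernel w (t * s) : ℂ) * u s := by
    filter_upwards [hT.slice_ae_eq hslice, ae_restrict_mem measurableSet_Ioi] with s hs hs1
    rw [hs, RCLike.inner_apply, Complex.conj_ofReal, mul_comm,
      integral_powerKernel_mul_powerKernel hw (by positivity) (by positivity),
      max_eq_left (le_of_lt ht1), max_eq_left (le_of_lt hs1)]
  refine ⟨(L2.integrable_inner (𝕜 := ℂ) (T (hslice.toLp _)) u).congr hae, ?_⟩
  rw [comp_apply, ht.2, integral_ofReal_mul_eq_inner hslice, adjoint_inner_right, L2.inner_def]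
  exact integral_congr_ae hae

theorem isHelsonMatrix_of_isKernelOperator (hv : IsWeight v D R)
    (hw : ∀ᵐ x ∂(volume.restrict (Ioi (0 : ℝ))), w x = v x ^ 2)
    {T : LTwoIoi 0 →L[ℂ] Lp ℂ 2 (Measure.count : Measure ℕ+)}
    (hT : IsKernelOperator (powerKernel (fun j : ℕ+ => (j : ℝ)) v) T)
    {S : LTwoIoi 0 →L[ℂ] EllTwo} (hS : S = lpOfLpCount.toContinuousLinearMap ∘L T) :
    IsHelsonMatrix (fun j : ℕ+ => (helsonKernel w (j : ℝ) : ℂ)) (S ∘L adjoint S) := by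
  intro u j
  have hSj : ∀ f i, S f i = T f i := fun f i => by rw [hS]; rfl
  have hslice := hv.memLp_powerKernel (φ := fun j : ℕ+ => (j : ℝ)) (t := j)
    (by exact_mod_cast j.pos)
  have h1 : (S ∘L adjoint S) u j = inner ℂ (S (hslice.toLp _)) u := by
    rw [comp_apply, hSj, (Measure.ae_count_iff.1 (hT (adjoint S u)) j).2,
      integral_ofReal_mul_eq_inner hslice, adjoint_inner_right]
  rw [h1]
  refine (lp.hasSum_inner (S (hslice.toLp _)) u).congr_fun fun i => ?_
  rw [hSj, Measure.ae_count_iff.1 (hT.slice_ae_eq hslice) i, RCLike.inner_apply,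
    Complex.conj_ofReal, mul_comm,
    integral_powerKernel_mul_powerKernel hw (by positivity) (by positivity)]
  push_cast
  rfl

theorem integrable_max_rpow {s : ℝ} (hs : 0 < s) :
    Integrable (fun t : ℝ => (max t 1) ^ (-1 - s)) (volume.restrict (Ioi 1)) := by
  refine (integrableOn_Ioi_rpow_of_lt (a := -1 - s) (by linarith) one_pos).congr ?_
  filter_upwards [ae_restrict_mem measurableSet_Ioi] with t ht
  rw [max_eq_left (le_of_lt ht)]

theorem integral_max_rpow {s : ℝ} (hs : 0 < s) :
    ∫ t in Ioi (1 : ℝ), (max t 1) ^ (-1 - s) = 1 / s := by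
  have h : ∫ t in Ioi (1 : ℝ), (max t 1) ^ (-1 - s) = ∫ t in Ioi (1 : ℝ), t ^ (-1 - s) :=
    setIntegral_congr_fun measurableSet_Ioi fun t ht => by
      simp only [max_eq_left (le_of_lt (mem_Ioi.1 ht))]
  rw [h, integral_Ioi_rpow_of_lt (by linarith) one_pos, Real.one_rpow]
  have : -1 - s + 1 = -s := by ring
  rw [this, neg_div_neg_eq]

theorem integrable_pnat_rpow {s : ℝ} (hs : 0 < s) :
    Integrable (fun j : ℕ+ => (j : ℝ) ^ (-1 - s)) Measure.count :=
  integrable_count_iff.2 (summable_pnat_rpow hs).norm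

/-- A weight with `w = v²` almost everywhere on `(0, ∞)`. -/
theorem exists_isWeight_sq_eq (hw_meas : AEMeasurable w (volume.restrict (Ioi (0 : ℝ))))
    (hw_nonneg : ∀ x : ℝ, 0 < x → 0 ≤ w x)
    (hw_bdd : ∃ C : ℝ, ∀ x : ℝ, 0 < x → w x ≤ C)
    (hw_supp : ∃ R : ℝ, ∀ x : ℝ, 0 < x → R < x → w x = 0) :
    ∃ (v : ℝ → ℝ) (D R : ℝ), IsWeight v D R ∧
      ∀ᵐ x ∂(volume.restrict (Ioi (0 : ℝ))), w x = v x ^ 2 := by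
  obtain ⟨C, hC⟩ := hw_bdd
  obtain ⟨R, hR⟩ := hw_supp
  -- The measurable representative agrees with `w` only almost everywhere, so the bound and the
  -- support are imposed by `min` and the indicator; `max R 1` ensures a positive radius.
  refine ⟨(Ioc 0 (max R 1)).indicator fun x => √(min (hw_meas.mk w x) C), √C, max R 1,
    ⟨?_, ?_, ?_, ?_, ?_⟩, ?_⟩
  · exact Measurable.indicator ((hw_meas.measurable_mk.min measurable_const).sqrt) measurableSet_Ioc
  · exact fun x => indicator_nonneg (fun _ _ => Real.sqrt_nonneg _) x
  · intro x
    refine indicator_apply_le' (fun _ => ?_) fun _ => Real.sqrt_nonneg _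
    exact Real.sqrt_le_sqrt (min_le_right _ _)
  · exact lt_max_of_lt_right one_pos
  · intro x hx
    exact mem_Ioc.1 (mem_of_indicator_ne_zero hx)
  · filter_upwards [hw_meas.ae_eq_mk, ae_restrict_mem measurableSet_Ioi] with x hx hx0
    by_cases hm : x ∈ Ioc 0 (max R 1)
    · rw [indicator_of_mem hm, ← hx, min_eq_left (hC x hx0), Real.sq_sqrt (hw_nonneg x hx0)]
    · rw [indicator_of_notMem hm, zero_pow two_ne_zero]
      refine hR x hx0 (lt_of_le_of_lt (le_max_left R 1) (not_le.1 fun h => hm ⟨hx0, h⟩))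

end Helson

/-! ### Assembly of the theorem. -/

theorem theorem2p1 (w : ℝ → ℝ)
    (hw_meas : AEMeasurable w (volume.restrict (Set.Ioi (0 : ℝ))))
    (hw_nonneg : ∀ x : ℝ, 0 < x → 0 ≤ w x)
    (hw_bdd : ∃ C : ℝ, ∀ x : ℝ, 0 < x → w x ≤ C)
    (hw_supp : ∃ R : ℝ, ∀ x : ℝ, 0 < x → R < x → w x = 0) :
    ∃ (M : EllTwo →L[ℂ] EllTwo) (N : LTwoIoi 1 →L[ℂ] LTwoIoi 1),
      IsHelsonMatrix (fun j : ℕ+ => (helsonKernel w (j : ℝ) : ℂ)) M ∧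
      IsIntegralHelsonOperator (fun t : ℝ => (helsonKernel w t : ℂ)) N ∧
      M.IsPositive ∧ N.IsPositive ∧
      ∃ A B : LTwoIoi 0 →L[ℂ] LTwoIoi 0,
        IsSelfAdjoint A ∧ IsSelfAdjoint B ∧
        UnitarilyEquivModKer M A ∧ UnitarilyEquivModKer N B ∧
        MemSchattenZero (A - B) := by
  obtain ⟨v, D, R, hv, hw⟩ := exists_isWeight_sq_eq hw_meas hw_nonneg hw_bdd hw_supp
  obtain ⟨K, hK, hKζ⟩ := exists_entire_zeta_sub_pole
  have hR := hv.pos_R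
  have hζ : ∀ s : ℝ, 0 < s → ((∫ j : ℕ+, (j : ℝ) ^ (-1 - s) ∂Measure.count : ℝ) : ℂ) =
      ((1 / s : ℝ) : ℂ) + K s := fun s hs => by
    rw [integral_count_eq_tsum (integrable_pnat_rpow hs), tsum_pnat_rpow_eq_zeta hs,
      hKζ s (by exact_mod_cast hs.ne')]
    push_cast
    ring
  obtain ⟨c, hc⟩ : ∃ c, ∀ s ∈ Set.Icc 0 (2 * R), ‖K ((s : ℝ) : ℂ)‖ ≤ c :=
    isCompact_Icc.exists_bound_of_continuousOn
      (hK.continuous.comp Complex.continuous_ofReal).continuousOn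
  have hφ₁ : ∀ j : ℕ+, 0 < (j : ℝ) := fun j => by positivity
  have hφ₂ : ∀ t : ℝ, 0 < max t 1 := fun t => lt_max_of_lt_right one_pos
  -- From `ζ(1+s) = 1/s + K(s)` with `|K| ≤ c` on `[0, 2R]`; there `c ≤ 2Rc/s`, which gives the
  -- constant.
  have hG₁ := hv.gramDominated_powerKernel (ν := Measure.count) (c := 1 + 2 * R * c) hφ₁
    (fun s hs => integrable_pnat_rpow hs) fun s hs hsR => by
      have hn : |∫ j : ℕ+, (j : ℝ) ^ (-1 - s) ∂Measure.count| ≤ 1 / s + c := by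
        rw [← Real.norm_eq_abs, ← Complex.norm_real, hζ s hs]
        refine (norm_add_le _ _).trans (add_le_add ?_ (hc s ⟨hs.le, hsR⟩))
        rw [Complex.norm_real, Real.norm_of_nonneg (by positivity)]
      refine (le_abs_self _).trans (hn.trans ?_)
      have hc0 : 0 ≤ c := (norm_nonneg _).trans (hc s ⟨hs.le, hsR⟩)
      have : c ≤ 2 * R * c * (1 / s) := by
        rw [mul_one_div, le_div_iff₀ hs, mul_comm c s]
        gcongr
      linarith
  have hG₂ := hv.gramDominated_powerKernel (ν := volume.restrict (Set.Ioi (1 : ℝ))) (c := 1) hφ₂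
    (fun s hs => integrable_max_rpow hs) fun s hs _ => by rw [integral_max_rpow hs, one_mul]
  have hm₁ := measurable_powerKernel (φ := fun j : ℕ+ => (j : ℝ)) .of_discrete hv.measurable
  have hm₂ := measurable_powerKernel (φ := fun t : ℝ => max t 1) (by fun_prop) hv.measurable
  obtain ⟨T₁, hT₁⟩ := hG₁.exists_isKernelOperator hm₁
  obtain ⟨T₂, hT₂⟩ := hG₂.exists_isKernelOperator hm₂
  -- An isometric embedding suffices: it leaves `S* S = T₁* T₁` unchanged.
  set S : LTwoIoi 0 →L[ℂ] EllTwo := lpOfLpCount.toContinuousLinearMap ∘L T₁ with hS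
  refine ⟨S ∘L ContinuousLinearMap.adjoint S, T₂ ∘L ContinuousLinearMap.adjoint T₂,
    isHelsonMatrix_of_isKernelOperator hv hw hT₁ hS,
    isIntegralHelsonOperator_of_isKernelOperator hv hw hT₂,
    ContinuousLinearMap.isPositive_self_comp_adjoint S,
    ContinuousLinearMap.isPositive_self_comp_adjoint T₂,
    ContinuousLinearMap.adjoint S ∘L S, ContinuousLinearMap.adjoint T₂ ∘L T₂,
    (ContinuousLinearMap.isPositive_adjoint_comp_self S).isSelfAdjoint,
    (ContinuousLinearMap.isPositive_adjoint_comp_self T₂).isSelfAdjoint, ?_, ?_, ?_⟩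
  · simpa using unitarilyEquivModKer_adjoint_comp_self (ContinuousLinearMap.adjoint S)
  · simpa using unitarilyEquivModKer_adjoint_comp_self (ContinuousLinearMap.adjoint T₂)
  refine hv.memSchattenZero_of_entire hK _ fun f g => ?_
  obtain ⟨i₁, e₁⟩ := hT₁.inner_eq hG₁ hm₁ f g
  obtain ⟨i₂, e₂⟩ := hT₂.inner_eq hG₂ hm₂ f g
  -- The cancellation of the pole: the two Gram kernels differ exactly by `v(x) v(y) K(x+y)`. Where
  -- a weight vanishes both sides are zero; elsewhere `x + y > 0` and the zeta identity applies.
  have hker : ∀ q : ℝ × ℝ,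
      (starRingEnd ℂ) (f q.1) * g q.2 * (v q.1 * v q.2 * K ((q.1 + q.2 : ℝ) : ℂ)) =
      (starRingEnd ℂ) (f q.1) * g q.2 * ((∫ j, powerKernel (fun j : ℕ+ => (j : ℝ)) v j q.1 *
        powerKernel (fun j : ℕ+ => (j : ℝ)) v j q.2 ∂Measure.count : ℝ) : ℂ) -
      (starRingEnd ℂ) (f q.1) * g q.2 * ((∫ t in Set.Ioi (1 : ℝ),
        powerKernel (fun t : ℝ => max t 1) v t q.1 *
        powerKernel (fun t : ℝ => max t 1) v t q.2 : ℝ) : ℂ) := by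
    intro q
    rw [integral_gram_powerKernel hφ₁, integral_gram_powerKernel hφ₂]
    by_cases h : v q.1 = 0 ∨ v q.2 = 0
    · rcases h with h | h <;> simp [h]
    push Not at h
    have hs : 0 < q.1 + q.2 := add_pos (hv.support _ h.1).1 (hv.support _ h.2).1
    rw [integral_max_rpow hs, Complex.ofReal_mul, hζ _ hs]
    push_cast
    ring
  simp_rw [hker]
  refine ⟨i₁.sub i₂, ?_⟩
  rw [integral_sub i₁ i₂, ← e₁, ← e₂, sub_apply, inner_sub_right, ContinuousLinearMap.comp_apply,
    ContinuousLinearMap.adjoint_inner_right,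
    ContinuousLinearMap.comp_apply (ContinuousLinearMap.adjoint T₂),
    ContinuousLinearMap.adjoint_inner_right]
  congr 1
  exact lpOfLpCount.inner_map_map (T₁ f) (T₁ g)
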